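/- Notation. $s_\lambda$ is the Schur function of a partition $\lambda$, and $s_D=\sum_T w(T)$ (sum over semistandard tableaux $T$ of shape $D$) is the Schur function of a skew diagram $D$; $\langle\ ,\ \rangle$ is the Hall inner product, $\langle s_\lambda,s_\mu\rangle=\delta_{\lambda\mu}$; $\mu'$ is the conjugate of $\mu$; $D^*$ is the diagram $D$ rotated by $180^\circ$; for $\mu\subseteq(m^m)$, $\mu^{c}=\mu^{c,m}=((m^m)/\mu)^*$ is the complement of $\mu$ in the square $(m^m)$. Put $c^{\mu'}_{\gamma\,\sigma\,(\mu/\eta)^*}=\langle s_{\mu'},\,s_\gamma s_\sigma s_{(\mu/\eta)^*}\rangle$. For partitions $\eta\subseteq(m^m)$, $\gamma$, $\sigma$, write $\lambda=(\eta^{c,m}+\gamma,\sigma)$ if $\lambda$ is a partition, $\lambda_i=m-\eta_{m+1-i}+\gamma_i$ for $1\le i\le m$, $\lambda_{m+i}=\sigma_i$ for $i\ge1$, and $\gamma$ lies in rows above those of the removed $\eta^*$, i.e. $\ell(\gamma)+\ell(\eta)\le m$. (So $\lambda$ is obtained from the square $(m^m)$ by removing $\eta^*$ from its lower right corner and attaching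 $\gamma$ to its right and $\sigma$ to its bottom.) (1) Let $\mu$ be a partition and $m\ge\mu_1+\ell(\mu)$ an integer. Let $\eta\subseteq\mu$, $\gamma$, $\sigma$ be partitions with $|\gamma|+|\sigma|=|\eta|$. If $\lambda=(\eta^{c,m}+\gamma,\sigma)$, then the coefficient of $s_\lambda$ in the Schur expansion of $s_{\mu'}s_{\mu^c}$ is $c^{\mu'}_{\gamma\,\sigma\,(\mu/\eta)^*}$. If moreover $\overline\lambda=(\eta^{c,m}+\sigma,\gamma)$, then the coefficients of $s_\lambda$ and $s_{\overline\lambda}$ in $s_{\mu'}s_{\mu^c}$ are equal. (2) Let $\nu\subseteq\mu$ be partitions with $|\mu|=|\nu|+1$, and let $m_1,m_2\ge\mu_1+\ell(\mu)$. Then for all partitions $\eta,\gamma,\sigma$ with $|\gamma|+|\sigma|=|\eta|$ for which $(\eta^{c,m_1}+\gamma,\sigma)$ and $(\eta^{c,m_2}+\gamma,\sigma)$ are defined as above, $$\langle s_{(\eta^{c,m_1}+\gamma,\sigma)},\ s_{\mu'}s_{\mu^{c,m_1}}-s_{\nu'}s_{\nu^{c,m_1}}\rangle=\langle s_{(\eta^{c,m_2}+\gamma,\sigma)},\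 s_{\mu'}s_{\mu^{c,m_2}}-s_{\nu'}s_{\nu^{c,m_2}}\rangle .$$ Here all the symmetric functions that occur have a unique finite expansion in Schur functions. -/

import Mathlib

namespace SchurStability

/-- The weight of a filling `T` of the cells of `D`, as an exponent vector: the exponent of the
variable `x_k` is the number of cells labelled `k`. Labels and variables are indexed by
`0, 1, 2, …` instead of `1, 2, 3, …`. -/
noncomputable def weight (D : Finset (ℕ × ℕ)) (T : D → ℕ) : ℕ →₀ ℕ :=
  ∑ p : D, Finsupp.single (T p) 1

/-- `T` is a semistandard filling of the (skew) diagram `D`; a cell `(i, j)` lies in row `i` and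
column `j`, as in `YoungDiagram`. -/
structure IsSemistandard (D : Finset (ℕ × ℕ)) (T : D → ℕ) : Prop where
  row_weak : ∀ p q : D, p.1.1 = q.1.1 → p.1.2 < q.1.2 → T p ≤ T q
  col_strict : ∀ p q : D, p.1.2 = q.1.2 → p.1.1 < q.1.1 → T p < T q

/-- The (skew) Schur function `∑_T w(T)` of the (skew) diagram `D`, a formal power series in
`x_0, x_1, x_2, …`: the coefficient of a monomial is the number of semistandard fillings of `D`
of that weight. -/
noncomputable def diagramSchur (D : Finset (ℕ × ℕ)) : MvPowerSeries ℕ ℤ :=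
  fun t => (Nat.card {T : D → ℕ // IsSemistandard D T ∧ weight D T = t} : ℤ)

/-- The number of fillings counted in `diagramSchur` is finite. -/
theorem finite_fillings (D : Finset (ℕ × ℕ)) (t : ℕ →₀ ℕ) :
    Finite {T : D → ℕ // IsSemistandard D T ∧ weight D T = t} := by
  classical
  have key : ∀ T : {T : D → ℕ // IsSemistandard D T ∧ weight D T = t}, ∀ p : D,
      T.1 p ∈ t.support := by
    intro T p
    have h : weight D T.1 (T.1 p) = t (T.1 p) := by rw [T.2.2]
    rw [Finsupp.mem_support_iff, ← h, weight, Finsupp.finsetSum_apply]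
    have : (1 : ℕ) ≤ ∑ q : D, (Finsupp.single (T.1 q) 1 : ℕ →₀ ℕ) (T.1 p) :=
      le_trans (by simp) (Finset.single_le_sum
        (f := fun q : D => (Finsupp.single (T.1 q) 1 : ℕ →₀ ℕ) (T.1 p))
        (fun _ _ => Nat.zero_le _) (Finset.mem_univ p))
    omega
  refine Finite.of_injective
    (fun T => (fun p => ⟨T.1 p, key T p⟩ : D → t.support)) ?_
  intro T T' h
  apply Subtype.ext
  funext p
  exact congrArg Subtype.val (congrFun h p)

/-- The Schur function `s_lam`. -/
noncomputable def schur (lam : YoungDiagram) : MvPowerSeries ℕ ℤ :=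
  diagramSchur lam.cells

/-- `f` is, in exactly one way, a finite integer linear combination of Schur functions. -/
def HasSchurExpansion (f : MvPowerSeries ℕ ℤ) : Prop :=
  ∃! c : YoungDiagram →₀ ℤ, Finsupp.linearCombination ℤ schur c = f

open Classical in
/-- The Schur expansion of `f` (zero if `HasSchurExpansion f` fails). -/
noncomputable def schurExpansion (f : MvPowerSeries ℕ ℤ) : YoungDiagram →₀ ℤ :=
  if h : HasSchurExpansion f then h.choose else 0

/-- The coefficient of `s_lam` in the Schur expansion of `f`. -/
noncomputable def schurCoeff (lam : YoungDiagram) (f : MvPowerSeries ℕ ℤ) : ℤ :=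
  schurExpansion f lam

/-- The Hall inner product: the bilinear form for which the Schur functions are orthonormal. -/
noncomputable def hallInner (f g : MvPowerSeries ℕ ℤ) : ℤ :=
  (schurExpansion f).sum fun lam a => a * schurExpansion g lam

/-- The diagram `D` rotated by 180 degrees inside the rectangle with `r` rows and `c` columns
(which is meant to contain `D`). -/
def rotate (r c : ℕ) (D : Finset (ℕ × ℕ)) : Finset (ℕ × ℕ) :=
  D.image fun p => (r - 1 - p.1, c - 1 - p.2)

/-- The complement `μ^c = ((m^m)/μ)^*` of `μ` in the square `(m^m)`. -/
def complement (m : ℕ) (μ : YoungDiagram) : YoungDiagram where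
  cells := rotate m m ((Finset.range m ×ˢ Finset.range m) \ μ.cells)
  isLowerSet := by
    rintro ⟨a, b⟩ ⟨a', b'⟩ ⟨ha : a' ≤ a, hb : b' ≤ b⟩ h
    simp only [rotate, Finset.coe_image, Set.mem_image, Finset.mem_coe, Finset.mem_sdiff,
      Finset.mem_product, Finset.mem_range, YoungDiagram.mem_cells, Prod.mk.injEq,
      Prod.exists] at h ⊢
    obtain ⟨i, j, ⟨⟨hi, hj⟩, hn⟩, h1, h2⟩ := h
    refine ⟨m - 1 - a', m - 1 - b', ⟨⟨by omega, by omega⟩, fun hmem => hn ?_⟩, by omega, by omega⟩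
    exact μ.up_left_mem (by omega) (by omega) hmem

/-- The rotated skew diagram `(μ/η)^*`, placed in the rectangle with `ℓ(μ)` rows and `μ_1`
columns. -/
def rotatedSkew (μ η : YoungDiagram) : Finset (ℕ × ℕ) :=
  rotate (μ.colLen 0) (μ.rowLen 0) (μ.cells \ η.cells)

/-- `s_{μ'} s_{μ^c}`, the complement being taken in `(m^m)`. -/
noncomputable def conjCompl (m : ℕ) (μ : YoungDiagram) : MvPowerSeries ℕ ℤ :=
  schur μ.transpose * schur (complement m μ)

/-- `lam` is the partition `(η^c + γ, σ)`: the diagram `η ⊆ (m^m)` is rotated and removed from the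
lower right corner of the square `(m^m)`, `γ` is attached to the right side of the square and `σ`
to its bottom. The diagram `γ` lies in rows above those of the removed `η^*`. -/
structure IsAttached (m : ℕ) (η γ σ lam : YoungDiagram) : Prop where
  width_le : η.rowLen 0 ≤ m
  height_le : γ.colLen 0 + η.colLen 0 ≤ m
  upper : ∀ i < m, lam.rowLen i = (complement m η).rowLen i + γ.rowLen i
  lower : ∀ i, lam.rowLen (m + i) = σ.rowLen i

end SchurStability

namespace SchurStability

open Finset

/-! Multiplication by `s_β` is adjoint to skewing, so the coefficient of `s_lam` in `s_{μ'} s_{μ^c}`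
is that of `s_{μ'}` in the skew function of `lam / μ^c` (`schurCoeff_mul_eq`). That skew shape
consists of `γ` to the right of the square, `σ` below it and `(μ/η)^*` in its lower right corner. If
`ℓ(γ) ≤ μ_1` and `σ_1 ≤ ℓ(μ)`, then `m ≥ μ_1 + ℓ(μ)` keeps the pieces from sharing rows or columns,
and the skew function is the product of three factors. If one of these bounds fails, both sides
vanish: `μ'` does not contain `γ` or `σ`, and `lam` is too long in one direction to occur in the
product. The formula is symmetric in `γ` and `σ` and free of `m`, which gives the symmetry and the
stability; when `η ⊄ μ` the coefficient is zero for every admissible `m`.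

The Schur function theory is built from tableaux. Removing the largest label gives a branching rule
(`kostka_add_single`). A local rule on horizontal strips (`sum_above_below`) then gives Pieri's rule
by induction on the number of variables. Iterating Pieri expands `h_t s_β` with skew Kostka numbers
as coefficients. Unitriangularity of Kostka numbers yields uniqueness of Schur expansions and turns
the statements about the `h_t` into statements about products of Schur functions, including the
adjointness. -/

/-! ### Weights of fillings and diagrams of given size. -/

theorem weight_restrict (D : Finset (ℕ × ℕ)) (g : ℕ × ℕ → ℕ) :
    weight D (fun p => g p) = ∑ p ∈ D, Finsupp.single (g p) 1 := by
  rw [weight, ← Finset.sum_coe_sort D]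

theorem weight_apply_ne_zero (D : Finset (ℕ × ℕ)) (T : D → ℕ) (p : D) : weight D T (T p) ≠ 0 := by
  rw [weight, Finsupp.finsetSum_apply]
  have : (1 : ℕ) ≤ ∑ q : D, (Finsupp.single (T q) 1 : ℕ →₀ ℕ) (T p) :=
    le_trans (by simp) (Finset.single_le_sum
      (f := fun q : D => (Finsupp.single (T q) 1 : ℕ →₀ ℕ) (T p))
      (fun _ _ => Nat.zero_le _) (Finset.mem_univ p))
  omega

theorem degree_weight (D : Finset (ℕ × ℕ)) (T : D → ℕ) : (weight D T).degree = D.card := by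
  simp [weight, map_sum, Finsupp.degree_single]

theorem coeff_diagramSchur (D : Finset (ℕ × ℕ)) (t : ℕ →₀ ℕ) :
    MvPowerSeries.coeff t (diagramSchur D) =
      (Nat.card {T : D → ℕ // IsSemistandard D T ∧ weight D T = t} : ℤ) := rfl

theorem exists_filling_of_coeff_ne_zero {D : Finset (ℕ × ℕ)} {t : ℕ →₀ ℕ}
    (h : MvPowerSeries.coeff t (diagramSchur D) ≠ 0) :
    ∃ T : D → ℕ, IsSemistandard D T ∧ weight D T = t := by
  by_contra hc
  have : IsEmpty {T : D → ℕ // IsSemistandard D T ∧ weight D T = t} :=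
    ⟨fun T => hc ⟨T.1, T.2⟩⟩
  exact h (by rw [coeff_diagramSchur, Nat.card_of_isEmpty, Nat.cast_zero])

theorem degree_eq_of_coeff_ne_zero {D : Finset (ℕ × ℕ)} {t : ℕ →₀ ℕ}
    (h : MvPowerSeries.coeff t (diagramSchur D) ≠ 0) : t.degree = D.card := by
  obtain ⟨T, -, rfl⟩ := exists_filling_of_coeff_ne_zero h
  exact degree_weight D T

/-- The boxes of a diagram of size `n` lie in the square of side `n`. -/
theorem lt_card_of_mem {μ : YoungDiagram} {i j : ℕ} (h : (i, j) ∈ μ) :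
    i < μ.card ∧ j < μ.card := by
  constructor
  · have : (Finset.range (i + 1)).image (fun a => (a, j)) ⊆ μ.cells := by
      intro p hp
      obtain ⟨a, ha, rfl⟩ := Finset.mem_image.1 hp
      exact μ.up_left_mem (by simpa [Nat.lt_succ_iff] using ha) le_rfl h
    have h2 := Finset.card_le_card this
    rw [Finset.card_image_of_injective _ (fun a b hab => by simpa using hab),
      Finset.card_range] at h2
    exact h2
  · have : (Finset.range (j + 1)).image (fun a => (i, a)) ⊆ μ.cells := by
      intro p hp
      obtain ⟨a, ha, rfl⟩ := Finset.mem_image.1 hp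
      exact μ.up_left_mem le_rfl (by simpa [Nat.lt_succ_iff] using ha) h
    have h2 := Finset.card_le_card this
    rw [Finset.card_image_of_injective _ (fun a b hab => by simpa using hab),
      Finset.card_range] at h2
    exact h2

theorem cells_injective : Function.Injective YoungDiagram.cells := by
  intro a b h
  ext x
  simpa using Finset.ext_iff.1 h x

theorem finite_card_eq (n : ℕ) : {μ : YoungDiagram | μ.card = n}.Finite := by
  refine Set.Finite.of_finite_image (f := YoungDiagram.cells) ?_ cells_injective.injOn
  refine Set.Finite.subset (Finset.finite_toSet (Finset.range n ×ˢ Finset.range n).powerset) ?_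
  rintro _ ⟨μ, hμ, rfl⟩
  simp only [Finset.coe_powerset, Set.mem_preimage, Set.mem_powerset_iff, Finset.coe_subset]
  rintro ⟨i, j⟩ hp
  have := lt_card_of_mem (μ := μ) (by simpa using hp)
  simp only [Set.mem_ofPred_eq] at hμ
  simpa [hμ] using this

/-- The Young diagrams of size `n`. -/
noncomputable def ofSize (n : ℕ) : Finset YoungDiagram := (finite_card_eq n).toFinset

@[simp]
theorem mem_ofSize {n : ℕ} {μ : YoungDiagram} : μ ∈ ofSize n ↔ μ.card = n := by
  simp [ofSize]

/-! ### Horizontal strips, skew Kostka numbers and the branching rule. -/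

/-- The skew diagram `lam / κ` is a horizontal strip. -/
def IsHorizontalStrip (κ lam : YoungDiagram) : Prop :=
  κ ≤ lam ∧ ∀ i j, (i + 1, j) ∈ lam → (i, j) ∈ κ

open Classical in
/-- The diagrams obtained from `lam` by removing a horizontal strip of size `c`. -/
noncomputable def below (lam : YoungDiagram) (c : ℕ) : Finset YoungDiagram :=
  (ofSize (lam.card - c)).filter fun κ => IsHorizontalStrip κ lam ∧ κ.card + c = lam.card

open Classical in
/-- The diagrams obtained from `κ` by adding a horizontal strip of size `c`. -/
noncomputable def above (κ : YoungDiagram) (c : ℕ) : Finset YoungDiagram :=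
  (ofSize (κ.card + c)).filter fun lam => IsHorizontalStrip κ lam

theorem mem_below {κ lam : YoungDiagram} {c : ℕ} :
    κ ∈ below lam c ↔ IsHorizontalStrip κ lam ∧ κ.card + c = lam.card := by
  simp only [below, Finset.mem_filter, mem_ofSize, and_iff_right_iff_imp]
  rintro ⟨-, h⟩
  omega

theorem mem_above {κ lam : YoungDiagram} {c : ℕ} :
    lam ∈ above κ c ↔ IsHorizontalStrip κ lam ∧ lam.card = κ.card + c := by
  simp only [above, Finset.mem_filter, mem_ofSize, and_comm]

open Classical in
/-- The number of semistandard fillings of the skew diagram `lam / β` of weight `t`. -/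
noncomputable def kostka (β lam : YoungDiagram) (t : ℕ →₀ ℕ) : ℤ :=
  if β ≤ lam then MvPowerSeries.coeff t (diagramSchur (lam.cells \ β.cells)) else 0

theorem kostka_of_le {β lam : YoungDiagram} (h : β ≤ lam) (t : ℕ →₀ ℕ) :
    kostka β lam t = MvPowerSeries.coeff t (diagramSchur (lam.cells \ β.cells)) := if_pos h

theorem kostka_bot (lam : YoungDiagram) (t : ℕ →₀ ℕ) :
    kostka ⊥ lam t = MvPowerSeries.coeff t (schur lam) := by
  rw [kostka_of_le bot_le, YoungDiagram.cells_bot, Finset.sdiff_empty, schur]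

theorem le_of_kostka_ne_zero {β lam : YoungDiagram} {t : ℕ →₀ ℕ} (h : kostka β lam t ≠ 0) :
    β ≤ lam := by
  by_contra hc
  exact h (if_neg hc)

theorem card_sdiff_add {β lam : YoungDiagram} (h : β ≤ lam) :
    (lam.cells \ β.cells).card + β.card = lam.card :=
  Finset.card_sdiff_add_card_eq_card (YoungDiagram.cells_subset_iff.2 h)

theorem card_of_kostka_ne_zero {β lam : YoungDiagram} {t : ℕ →₀ ℕ} (h : kostka β lam t ≠ 0) :
    lam.card = β.card + t.degree := by
  have hle := le_of_kostka_ne_zero h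
  rw [kostka_of_le hle] at h
  rw [degree_eq_of_coeff_ne_zero h, ← card_sdiff_add hle, add_comm]

/-- The cells of `β` and those of `lam / β` with label less than `n`. -/
noncomputable def levelDiagram (n : ℕ) {β lam : YoungDiagram}
    (T : ↥(lam.cells \ β.cells) → ℕ) (hT : IsSemistandard _ T) : YoungDiagram where
  cells := lam.cells.filter fun p => ∀ h : p ∈ lam.cells \ β.cells, T ⟨p, h⟩ < n
  isLowerSet := by
    rintro ⟨a, b⟩ ⟨a', b'⟩ ⟨ha : a' ≤ a, hb : b' ≤ b⟩ h
    simp only [Finset.coe_filter, Set.mem_ofPred_eq] at h ⊢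
    obtain ⟨h1, h2⟩ := h
    have hm : ∀ x y, x ≤ a → y ≤ b → (x, y) ∈ lam.cells := fun x y hx hy => by
      simpa using lam.up_left_mem hx hy (by simpa using h1)
    refine ⟨hm _ _ ha hb, fun h => ?_⟩
    have hnot : ∀ x y, a' ≤ x → b' ≤ y → (x, y) ∉ β.cells := fun x y hx hy hxy =>
      (Finset.mem_sdiff.1 h).2 (by simpa using β.up_left_mem hx hy (by simpa using hxy))
    -- The labels are compared through the corner `(a', b)`, which is outside `β` because `(a', b')`
    -- is.
    have hq : (a', b) ∈ lam.cells \ β.cells :=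
      Finset.mem_sdiff.2 ⟨hm _ _ ha le_rfl, hnot _ _ le_rfl hb⟩
    have hp : (a, b) ∈ lam.cells \ β.cells := Finset.mem_sdiff.2 ⟨h1, hnot _ _ ha hb⟩
    have e1 : T ⟨(a', b'), h⟩ ≤ T ⟨(a', b), hq⟩ := by
      rcases hb.eq_or_lt with rfl | hb
      · rfl
      · exact hT.row_weak ⟨(a', b'), h⟩ ⟨(a', b), hq⟩ rfl hb
    have e2 : T ⟨(a', b), hq⟩ ≤ T ⟨(a, b), hp⟩ := by
      rcases ha.eq_or_lt with rfl | ha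
      · rfl
      · exact (hT.col_strict ⟨(a', b), hq⟩ ⟨(a, b), hp⟩ rfl ha).le
    exact (e1.trans e2).trans_lt (h2 hp)

/-- Extend a filling of `κ / β` to `lam / β` by the constant `n`. -/
noncomputable def extendFilling (n : ℕ) (β lam κ : YoungDiagram)
    (T : ↥(κ.cells \ β.cells) → ℕ) : ↥(lam.cells \ β.cells) → ℕ :=
  fun p => if h : p.1 ∈ κ.cells \ β.cells then T ⟨p.1, h⟩ else n

theorem weight_extendFilling (n : ℕ) {β lam κ : YoungDiagram} (h : κ ≤ lam)
    (T : ↥(κ.cells \ β.cells) → ℕ) :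
    weight _ (extendFilling n β lam κ T) =
      weight _ T + Finsupp.single n ((lam.cells \ β.cells) \ (κ.cells \ β.cells)).card := by
  classical
  have hsub : κ.cells \ β.cells ⊆ lam.cells \ β.cells :=
    Finset.sdiff_subset_sdiff (YoungDiagram.cells_subset_iff.2 h) le_rfl
  have h1 := weight_restrict (lam.cells \ β.cells)
    (fun p => if h : p ∈ κ.cells \ β.cells then T ⟨p, h⟩ else n)
  have h2 : weight (κ.cells \ β.cells) T = ∑ p ∈ κ.cells \ β.cells,
      Finsupp.single (if h : p ∈ κ.cells \ β.cells then T ⟨p, h⟩ else n) 1 := by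
    rw [← weight_restrict]
    congr 1
    funext p
    rw [dif_pos p.2]
  refine Eq.trans h1 ?_
  rw [h2, ← Finset.sum_sdiff hsub, add_comm]
  congr 1
  rw [Finset.sum_congr rfl (g := fun _ => Finsupp.single n 1)]
  · simp
  · intro p hp
    rw [dif_neg (Finset.mem_sdiff.1 hp).2]

theorem card_sdiff_sdiff {β lam κ : YoungDiagram} (hβ : β ≤ κ) (h : κ ≤ lam) :
    ((lam.cells \ β.cells) \ (κ.cells \ β.cells)).card + κ.card = lam.card := by
  have h1 := card_sdiff_add (hβ.trans h)
  have h2 := card_sdiff_add hβ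
  have h3 := Finset.card_sdiff_add_card_eq_card
    (Finset.sdiff_subset_sdiff (YoungDiagram.cells_subset_iff.2 h) (le_refl β.cells))
  omega

/-- Removing the cells with the largest label from a semistandard filling. -/
theorem kostka_add_single {β lam : YoungDiagram} {t : ℕ →₀ ℕ} {n : ℕ}
    (ht : ∀ i, n ≤ i → t i = 0) (c : ℕ) :
    kostka β lam (t + Finsupp.single n c) = ∑ κ ∈ below lam c, kostka β κ t := by
  classical
  by_cases hβ : β ≤ lam
  swap
  · rw [kostka, if_neg hβ]
    refine (Finset.sum_eq_zero fun κ hκ => ?_).symm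
    rw [kostka, if_neg fun h => hβ (h.trans (mem_below.1 hκ).1.1)]
  have hlt : ∀ (D : Finset (ℕ × ℕ)) (T : D → ℕ), weight D T = t → ∀ p, T p < n := by
    rintro D T hw p
    by_contra hc
    exact weight_apply_ne_zero D T p (by rw [hw]; exact ht _ (not_lt.1 hc))
  have hrhs : ∑ κ ∈ below lam c, kostka β κ t = ∑ κ : ↥((below lam c).filter (β ≤ ·)),
      (Nat.card {T : ↥(κ.1.cells \ β.cells) → ℕ // IsSemistandard _ T ∧ weight _ T = t} : ℤ) := by
    rw [Finset.sum_coe_sort _ (fun κ : YoungDiagram =>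
      (Nat.card {T : ↥(κ.cells \ β.cells) → ℕ // IsSemistandard _ T ∧ weight _ T = t} : ℤ)),
      Finset.sum_filter]
    rfl
  have hmem : ∀ κ : ↥((below lam c).filter (β ≤ ·)),
      β ≤ κ.1 ∧ IsHorizontalStrip κ.1 lam ∧ κ.1.card + c = lam.card := fun κ => by
    have := Finset.mem_filter.1 κ.2
    exact ⟨this.2, mem_below.1 this.1⟩
  have := fun κ : ↥((below lam c).filter (β ≤ ·)) => finite_fillings (κ.1.cells \ β.cells) t
  rw [hrhs, kostka_of_le hβ, coeff_diagramSchur, ← Nat.cast_sum, ← Nat.card_sigma]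
  congr 1
  symm
  have key : ∀ x : Σ κ : ↥((below lam c).filter (β ≤ ·)),
      {T : ↥(κ.1.cells \ β.cells) → ℕ // IsSemistandard _ T ∧ weight _ T = t},
      IsSemistandard _ (extendFilling n β lam x.1.1 x.2.1) ∧
        weight _ (extendFilling n β lam x.1.1 x.2.1) = t + Finsupp.single n c := by
    rintro ⟨κ, T, hT, hw⟩
    obtain ⟨h1, h2, h3⟩ := hmem κ
    have hT' := hlt _ T hw
    dsimp only
    refine ⟨⟨?_, ?_⟩, ?_⟩
    · rintro ⟨⟨i, j⟩, hp⟩ ⟨⟨i', j'⟩, hq⟩ (rfl : i = i') (hj : j < j')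
      simp only [extendFilling]
      by_cases hq' : (i, j') ∈ κ.1.cells \ β.cells
      · have hp' : (i, j) ∈ κ.1.cells \ β.cells := by
          refine Finset.mem_sdiff.2 ⟨?_, (Finset.mem_sdiff.1 hp).2⟩
          simpa using κ.1.up_left_mem le_rfl hj.le (by simpa using (Finset.mem_sdiff.1 hq').1)
        rw [dif_pos hp', dif_pos hq']
        exact hT.row_weak ⟨_, hp'⟩ ⟨_, hq'⟩ rfl hj
      · rw [dif_neg hq']
        split_ifs
        · exact (hT' _).le
        · exact le_rfl
    · rintro ⟨⟨i, j⟩, hp⟩ ⟨⟨i', j'⟩, hq⟩ (rfl : j = j') (hi : i < i')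
      have hp' : (i, j) ∈ κ.1.cells \ β.cells := by
        refine Finset.mem_sdiff.2 ⟨?_, (Finset.mem_sdiff.1 hp).2⟩
        -- A cell of `lam` with another one below it lies in `κ`, so two new labels `n` never share
        -- a column.
        have := h2.2 i j (lam.up_left_mem (Nat.succ_le_of_lt hi) le_rfl
          (by simpa using (Finset.mem_sdiff.1 hq).1))
        simpa using this
      simp only [extendFilling, dif_pos hp']
      split_ifs with hq'
      · exact hT.col_strict ⟨_, hp'⟩ ⟨_, hq'⟩ rfl hi
      · exact hT' _
    · rw [weight_extendFilling n h2.1, hw]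
      congr 2
      have := card_sdiff_sdiff h1 h2.1
      omega
  refine Nat.card_eq_of_bijective (fun x => ⟨extendFilling n β lam x.1.1 x.2.1, key x⟩) ⟨?_, ?_⟩
  · rintro ⟨κ, T, hT, hw⟩ ⟨κ', T', hT', hw'⟩ h
    have hfun : extendFilling n β lam κ.1 T = extendFilling n β lam κ'.1 T' := by
      simpa using h
    -- Old labels are less than `n`, so `κ` is recovered from the extended filling.
    have hlev : ∀ (κ : ↥((below lam c).filter (β ≤ ·))) (T : ↥(κ.1.cells \ β.cells) → ℕ),
        weight _ T = t → ∀ p : ↥(lam.cells \ β.cells),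
        p.1 ∈ κ.1.cells ↔ extendFilling n β lam κ.1 T p < n := by
      intro κ T hw p
      simp only [extendFilling]
      split_ifs with hp
      · simp only [hlt _ T hw _, iff_true]
        exact (Finset.mem_sdiff.1 hp).1
      · simp only [lt_self_iff_false, iff_false]
        exact fun h => hp (Finset.mem_sdiff.2 ⟨h, (Finset.mem_sdiff.1 p.2).2⟩)
    obtain rfl : κ = κ' := by
      apply Subtype.ext
      apply cells_injective
      ext p
      have hs := fun κ => YoungDiagram.cells_subset_iff.2 (hmem κ).1
      have hs' := fun κ => YoungDiagram.cells_subset_iff.2 (hmem κ).2.1.1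
      by_cases hb : p ∈ β.cells
      · exact ⟨fun _ => hs κ' hb, fun _ => hs κ hb⟩
      by_cases hl : p ∈ lam.cells
      · have hp : p ∈ lam.cells \ β.cells := Finset.mem_sdiff.2 ⟨hl, hb⟩
        exact (hlev κ T hw ⟨p, hp⟩).trans (by rw [hfun]; exact (hlev κ' T' hw' ⟨p, hp⟩).symm)
      · exact ⟨fun h => absurd (hs' κ h) hl, fun h => absurd (hs' κ' h) hl⟩
    obtain rfl : T = T' := by
      funext p
      have hp : p.1 ∈ lam.cells \ β.cells := Finset.mem_sdiff.2
        ⟨YoungDiagram.cells_subset_iff.2 (hmem κ).2.1.1 (Finset.mem_sdiff.1 p.2).1,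
          (Finset.mem_sdiff.1 p.2).2⟩
      have := congrFun hfun ⟨p.1, hp⟩
      simpa only [extendFilling, dif_pos p.2] using this
    rfl
  · rintro ⟨T, hT, hw⟩
    have hle : ∀ p, T p ≤ n := fun p => by
      by_contra hc
      refine weight_apply_ne_zero _ T p ?_
      rw [hw, Finsupp.add_apply, ht _ (by omega), Finsupp.single_apply, if_neg (by omega), add_zero]
    have hlam : levelDiagram n T hT ≤ lam :=
      YoungDiagram.cells_subset_iff.1 (Finset.filter_subset _ _)
    have hβκ : β ≤ levelDiagram n T hT := YoungDiagram.cells_subset_iff.1 fun p hp =>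
      Finset.mem_filter.2 ⟨YoungDiagram.cells_subset_iff.2 hβ hp,
        fun h => absurd hp (Finset.mem_sdiff.1 h).2⟩
    have hsd : (levelDiagram n T hT).cells \ β.cells ⊆ lam.cells \ β.cells :=
      Finset.sdiff_subset_sdiff (YoungDiagram.cells_subset_iff.2 hlam) le_rfl
    let T' : ↥((levelDiagram n T hT).cells \ β.cells) → ℕ := fun p => T ⟨p.1, hsd p.2⟩
    have hT' : IsSemistandard _ T' :=
      ⟨fun p q => hT.row_weak ⟨p.1, hsd p.2⟩ ⟨q.1, hsd q.2⟩,
        fun p q => hT.col_strict ⟨p.1, hsd p.2⟩ ⟨q.1, hsd q.2⟩⟩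
    have hext : extendFilling n β lam (levelDiagram n T hT) T' = T := by
      funext p
      simp only [extendFilling]
      split_ifs with h
      · rfl
      · have h1 : ¬ T p < n := fun hlt => h (Finset.mem_sdiff.2 ⟨Finset.mem_filter.2
          ⟨(Finset.mem_sdiff.1 p.2).1, fun _ => hlt⟩, (Finset.mem_sdiff.1 p.2).2⟩)
        have := hle p
        omega
    have hw2 := weight_extendFilling (β := β) n hlam T'
    rw [hext, hw] at hw2
    have hTn : weight _ T' n = 0 := by
      rw [weight, Finsupp.finsetSum_apply]
      refine Finset.sum_eq_zero fun p _ => ?_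
      have : T' p < n := (Finset.mem_filter.1 (Finset.mem_sdiff.1 p.2).1).2 (hsd p.2)
      rw [Finsupp.single_apply, if_neg this.ne]
    -- Comparing exponents of `x_n` shows that exactly `c` cells carry the label `n`.
    have hc := DFunLike.congr_fun hw2 n
    simp only [Finsupp.add_apply, ht n le_rfl, Finsupp.single_eq_same, zero_add, hTn] at hc
    rw [← hc] at hw2
    have hcard := card_sdiff_sdiff hβκ hlam
    have hstrip : IsHorizontalStrip (levelDiagram n T hT) lam := by
      refine ⟨hlam, fun i j hij => ?_⟩
      have hij' : (i + 1, j) ∈ lam.cells := hij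
      refine Finset.mem_filter.2 ⟨lam.up_left_mem (Nat.le_succ i) le_rfl hij, fun h => ?_⟩
      have hq : (i + 1, j) ∈ lam.cells \ β.cells := Finset.mem_sdiff.2 ⟨hij', fun hb =>
        (Finset.mem_sdiff.1 h).2 (β.up_left_mem (Nat.le_succ i) le_rfl hb)⟩
      exact (hT.col_strict ⟨_, h⟩ ⟨_, hq⟩ rfl (Nat.lt_succ_self i)).trans_le (hle _)
    refine ⟨⟨⟨_, Finset.mem_filter.2 ⟨mem_below.2 ⟨hstrip, by omega⟩, hβκ⟩⟩,
      ⟨T', hT', (add_right_cancel hw2).symm⟩⟩, ?_⟩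
    exact Subtype.ext hext

/-! ### Diagrams and horizontal strips in terms of row lengths. -/

theorem le_iff_rowLen {κ lam : YoungDiagram} : κ ≤ lam ↔ ∀ i, κ.rowLen i ≤ lam.rowLen i := by
  constructor
  · intro h i
    by_contra hc
    have h1 : (i, lam.rowLen i) ∈ κ := YoungDiagram.mem_iff_lt_rowLen.2 (not_le.1 hc)
    exact lt_irrefl _ (YoungDiagram.mem_iff_lt_rowLen.1 (h h1))
  · rintro h ⟨i, j⟩ hm
    exact YoungDiagram.mem_iff_lt_rowLen.2 ((YoungDiagram.mem_iff_lt_rowLen.1 hm).trans_le (h i))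

theorem eq_of_rowLen {κ lam : YoungDiagram} (h : ∀ i, κ.rowLen i = lam.rowLen i) : κ = lam :=
  le_antisymm (le_iff_rowLen.2 fun i => (h i).le) (le_iff_rowLen.2 fun i => (h i).ge)

theorem isHorizontalStrip_iff {κ lam : YoungDiagram} : IsHorizontalStrip κ lam ↔
    (∀ i, κ.rowLen i ≤ lam.rowLen i) ∧ ∀ i, lam.rowLen (i + 1) ≤ κ.rowLen i := by
  rw [IsHorizontalStrip, le_iff_rowLen]
  refine and_congr_right fun _ => forall_congr' fun i => ?_
  simp only [YoungDiagram.mem_iff_lt_rowLen]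
  exact ⟨fun h => not_lt.1 fun hc => lt_irrefl _ (h _ hc), fun h j hj => hj.trans_le h⟩

theorem rowLen_eq_zero_of_card_le {μ : YoungDiagram} {i : ℕ} (h : μ.card ≤ i) :
    μ.rowLen i = 0 := by
  by_contra hc
  have := (lt_card_of_mem (YoungDiagram.mem_iff_lt_rowLen.2 (Nat.pos_of_ne_zero hc))).1
  omega

theorem card_eq_sum_rowLen {μ : YoungDiagram} {N : ℕ} (h : μ.rowLen N = 0) :
    μ.card = ∑ i ∈ range N, μ.rowLen i := by
  have hm : Set.MapsTo Prod.fst (μ.cells : Set (ℕ × ℕ)) (range N : Set ℕ) := by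
    rintro ⟨i, j⟩ hp
    have hp' : (i, j) ∈ μ := hp
    rw [YoungDiagram.mem_iff_lt_rowLen] at hp'
    simp only [coe_range, Set.mem_Iio]
    by_contra hc
    have := μ.rowLen_anti N i (not_lt.1 hc)
    omega
  rw [YoungDiagram.card, Finset.card_eq_sum_card_fiberwise hm]
  exact Finset.sum_congr rfl fun i _ => μ.rowLen_eq_card.symm

/-- The Young diagram with given row lengths. -/
theorem exists_rowLen_eq (f : ℕ → ℕ) (hf : ∀ i, f (i + 1) ≤ f i) (N : ℕ) (hN : f N = 0) :
    ∃ μ : YoungDiagram, ∀ i, μ.rowLen i = f i := by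
  have ha : Antitone f := antitone_nat_of_succ_le hf
  have hm : ∀ i j, (i, j) ∈ (range N ×ˢ range (f 0)).filter (fun p => p.2 < f p.1) ↔ j < f i := by
    intro i j
    simp only [mem_filter, mem_product, mem_range, and_iff_right_iff_imp]
    intro h
    refine ⟨?_, h.trans_le (ha (Nat.zero_le i))⟩
    by_contra hc
    have := ha (not_lt.1 hc)
    omega
  refine ⟨⟨(range N ×ˢ range (f 0)).filter (fun p => p.2 < f p.1), ?_⟩, fun i => ?_⟩
  · rintro ⟨a, b⟩ ⟨a', b'⟩ ⟨h1 : a' ≤ a, h2 : b' ≤ b⟩ h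
    rw [mem_coe, hm] at h ⊢
    exact (h2.trans_lt h).trans_le (ha h1)
  · refine eq_of_forall_lt_iff fun j => ?_
    exact YoungDiagram.mem_iff_lt_rowLen.symm.trans (hm i j)

/-! ### The local rule and the commutation of adding and removing strips. -/

/-- The local rule relating horizontal strips `lam / β`, `lam / κ` to horizontal strips
`β / ρ`, `κ / ρ`. -/
structure LocalRule (β κ lam ρ : YoungDiagram) (j : ℕ) : Prop where
  zero : lam.rowLen 0 = max (β.rowLen 0) (κ.rowLen 0) + j
  succ : ∀ i, lam.rowLen (i + 1) + ρ.rowLen i =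
    max (β.rowLen (i + 1)) (κ.rowLen (i + 1)) + min (β.rowLen i) (κ.rowLen i)

/-- Sum the rule over all rows and use `max + min = β_i + κ_i`. The index shift costs nothing, since
the minimum vanishes in the last row. -/
theorem LocalRule.card {β κ lam ρ : YoungDiagram} {j : ℕ} (h : LocalRule β κ lam ρ j) :
    lam.card + ρ.card = j + β.card + κ.card := by
  set N := lam.card + ρ.card + β.card + κ.card with hN
  rw [card_eq_sum_rowLen (μ := lam) (N := N + 1) (rowLen_eq_zero_of_card_le (by omega)),
    card_eq_sum_rowLen (μ := ρ) (N := N) (rowLen_eq_zero_of_card_le (by omega)),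
    card_eq_sum_rowLen (μ := β) (N := N + 1) (rowLen_eq_zero_of_card_le (by omega)),
    card_eq_sum_rowLen (μ := κ) (N := N + 1) (rowLen_eq_zero_of_card_le (by omega)),
    Finset.sum_range_succ', h.zero, add_assoc j, ← Finset.sum_add_distrib]
  have h1 : ∑ i ∈ range (N + 1), (β.rowLen i + κ.rowLen i) =
      ∑ i ∈ range (N + 1), max (β.rowLen i) (κ.rowLen i) +
        ∑ i ∈ range (N + 1), min (β.rowLen i) (κ.rowLen i) := by
    rw [← Finset.sum_add_distrib]
    exact Finset.sum_congr rfl fun i _ => (max_add_min _ _).symm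
  rw [h1, Finset.sum_range_succ', Finset.sum_range_succ (fun i => min _ _),
    rowLen_eq_zero_of_card_le (μ := β) (i := N) (by omega), Nat.zero_min, add_zero]
  have h2 : ∑ i ∈ range N, lam.rowLen (i + 1) + ∑ i ∈ range N, ρ.rowLen i =
      ∑ i ∈ range N, max (β.rowLen (i + 1)) (κ.rowLen (i + 1)) +
        ∑ i ∈ range N, min (β.rowLen i) (κ.rowLen i) := by
    rw [← Finset.sum_add_distrib, ← Finset.sum_add_distrib]
    exact Finset.sum_congr rfl fun i _ => h.succ i
  omega

/-- Both strip conditions on `lam` and `ρ` say that `lam_{i+1}` and `ρ_i` lie between `max(β_{i+1},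
κ_{i+1})` and `min(β_i, κ_i)`. The rule reflects this interval, hence preserves it. Only `lam_0` has
no upper bound; its excess is recorded as `j`. -/
theorem exists_lower {β κ lam : YoungDiagram} (h1 : IsHorizontalStrip β lam)
    (h2 : IsHorizontalStrip κ lam) : ∃ ρ j, LocalRule β κ lam ρ j ∧
      IsHorizontalStrip ρ β ∧ IsHorizontalStrip ρ κ := by
  rw [isHorizontalStrip_iff] at h1 h2
  obtain ⟨ρ, hρ⟩ := exists_rowLen_eq (fun i => max (β.rowLen (i + 1)) (κ.rowLen (i + 1)) +
      min (β.rowLen i) (κ.rowLen i) - lam.rowLen (i + 1))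
    (fun i => by
      have := h1.1 (i + 1); have := h1.2 i; have := h1.1 (i + 2)
      have := h2.1 (i + 1); have := h2.2 i; have := h2.1 (i + 2)
      rw [show i + 1 + 1 = i + 2 from rfl]
      omega) (β.card + κ.card) (by
      have := h1.1 (β.card + κ.card + 1); have := h2.1 (β.card + κ.card + 1)
      have := rowLen_eq_zero_of_card_le (μ := β) (i := β.card + κ.card) (by omega)
      omega)
  refine ⟨ρ, lam.rowLen 0 - max (β.rowLen 0) (κ.rowLen 0), ⟨?_, fun i => ?_⟩, ?_, ?_⟩
  · have := h1.1 0; have := h2.1 0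
    omega
  · rw [hρ]
    have := h1.2 i; have := h2.2 i
    omega
  all_goals
    rw [isHorizontalStrip_iff]
    refine ⟨fun i => ?_, fun i => ?_⟩ <;> rw [hρ] <;>
    · have := h1.1 (i + 1); have := h1.2 i
      have := h2.1 (i + 1); have := h2.2 i
      omega

/-- The same reflection read backwards, with `j` prescribing the free part of the top row. -/
theorem exists_upper {β κ ρ : YoungDiagram} (h1 : IsHorizontalStrip ρ β)
    (h2 : IsHorizontalStrip ρ κ) (j : ℕ) : ∃ lam, LocalRule β κ lam ρ j ∧
      IsHorizontalStrip β lam ∧ IsHorizontalStrip κ lam := by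
  rw [isHorizontalStrip_iff] at h1 h2
  obtain ⟨lam, h0⟩ := exists_rowLen_eq (fun i => i.casesOn (max (β.rowLen 0) (κ.rowLen 0) + j)
      fun i => max (β.rowLen (i + 1)) (κ.rowLen (i + 1)) +
        min (β.rowLen i) (κ.rowLen i) - ρ.rowLen i)
    (fun i => by
      have := h1.1 i; have := h1.2 i; have := h2.1 i; have := h2.2 i
      cases i with
      | zero =>
        change max (β.rowLen 1) (κ.rowLen 1) + min (β.rowLen 0) (κ.rowLen 0) - ρ.rowLen 0 ≤
          max (β.rowLen 0) (κ.rowLen 0) + j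
        rw [zero_add] at *
        omega
      | succ i =>
        have := h1.1 i; have := h2.1 i
        dsimp only at *; omega) (β.card + κ.card + 1) (by
      have := h1.2 (β.card + κ.card); have := h2.2 (β.card + κ.card)
      have := rowLen_eq_zero_of_card_le (μ := β) (i := β.card + κ.card) (by omega)
      have := rowLen_eq_zero_of_card_le (μ := β) (i := β.card + κ.card + 1) (by omega)
      have := rowLen_eq_zero_of_card_le (μ := κ) (i := β.card + κ.card + 1) (by omega)
      dsimp only
      omega)
  have hz : lam.rowLen 0 = max (β.rowLen 0) (κ.rowLen 0) + j := h0 0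
  have hs : ∀ i, lam.rowLen (i + 1) = max (β.rowLen (i + 1)) (κ.rowLen (i + 1)) +
    min (β.rowLen i) (κ.rowLen i) - ρ.rowLen i := fun i => h0 (i + 1)
  refine ⟨lam, ⟨hz, fun i => ?_⟩, ?_, ?_⟩
  · rw [hs]
    have := h1.1 i; have := h2.1 i
    omega
  all_goals
    rw [isHorizontalStrip_iff]
    refine ⟨fun i => ?_, fun i => ?_⟩
    · cases i with
      | zero => omega
      | succ i =>
        have := h1.1 i; have := h2.1 i; have := hs i
        omega
    · have := h1.2 i; have := h2.2 i; have := hs i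
      omega

theorem LocalRule.eq_upper {β κ lam lam' ρ : YoungDiagram} {j : ℕ} (h : LocalRule β κ lam ρ j)
    (h' : LocalRule β κ lam' ρ j) : lam = lam' := by
  refine eq_of_rowLen fun i => ?_
  cases i with
  | zero => rw [h.zero, h'.zero]
  | succ i =>
    have := h.succ i
    have := h'.succ i
    omega

theorem LocalRule.eq_lower {β κ lam ρ ρ' : YoungDiagram} {j j' : ℕ} (h : LocalRule β κ lam ρ j)
    (h' : LocalRule β κ lam ρ' j') : ρ = ρ' ∧ j = j' := by
  refine ⟨eq_of_rowLen fun i => ?_, ?_⟩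
  · have := h.succ i
    have := h'.succ i
    omega
  · have := h.zero
    have := h'.zero
    omega

/-- Adding and removing horizontal strips commute up to the local rule. -/
theorem sum_above_below (β : YoungDiagram) (k c : ℕ) (g : YoungDiagram → ℤ) :
    ∑ lam ∈ above β k, ∑ κ ∈ below lam c, g κ =
      ∑ q ∈ antidiagonal c, if q.1 ≤ k then
        ∑ ρ ∈ below β q.2, ∑ κ ∈ above ρ (k - q.1), g κ else 0 := by
  rw [← Finset.sum_filter]
  simp_rw [Finset.sum_sigma']
  have key : ∀ x ∈ (above β k).sigma fun lam => below lam c, ∃ ρ j, LocalRule β x.2 x.1 ρ j ∧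
      IsHorizontalStrip ρ β ∧ IsHorizontalStrip ρ x.2 := fun x hx => by
    obtain ⟨h1, h2⟩ := Finset.mem_sigma.1 hx
    exact exists_lower (mem_above.1 h1).1 (mem_below.1 h2).1
  choose! r j hrule h1 h2 using key
  -- The bijection replaces `lam` by `ρ` and `j` and leaves `κ` alone, so `g κ` is unchanged. By
  -- `LocalRule.card`, `β / ρ` has `c - j` cells and `κ / ρ` has `k - j`.
  refine Finset.sum_bij (fun x _ => (⟨(j x, c - j x), ⟨r x, x.2⟩⟩ :
    Σ _ : ℕ × ℕ, Σ _ : YoungDiagram, YoungDiagram)) ?_ ?_ ?_ ?_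
  · rintro ⟨lam, κ⟩ hx
    obtain ⟨ha, hb⟩ := Finset.mem_sigma.1 hx
    have hr := hrule _ hx
    have hs1 := h1 _ hx
    have hs2 := h2 _ hx
    generalize r ⟨lam, κ⟩ = ρ at *
    generalize j ⟨lam, κ⟩ = j at *
    have hc : lam.card + ρ.card = j + β.card + κ.card := hr.card
    have hca : lam.card = β.card + k := (mem_above.1 ha).2
    have hcb : κ.card + c = lam.card := (mem_below.1 hb).2
    have hle1 : ρ.card ≤ β.card := Finset.card_le_card (YoungDiagram.cells_subset_iff.2 hs1.1)
    have hle2 : ρ.card ≤ κ.card := Finset.card_le_card (YoungDiagram.cells_subset_iff.2 hs2.1)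
    simp only [Finset.mem_sigma, Finset.mem_filter, HasAntidiagonal.mem_antidiagonal, mem_above,
      mem_below]
    refine ⟨⟨?_, ?_⟩, ⟨hs1, ?_⟩, hs2, ?_⟩ <;> omega
  · rintro ⟨lam, κ⟩ hx ⟨lam', κ'⟩ hx' h
    simp only [Sigma.mk.injEq, Prod.mk.injEq, heq_eq_eq] at h
    obtain ⟨⟨hj, -⟩, hρ, rfl⟩ := h
    have h3 := hrule _ hx
    have h4 := hrule _ hx'
    rw [hj, hρ] at h3
    obtain rfl : lam = lam' := h3.eq_upper h4
    rfl
  · rintro ⟨⟨c1, c2⟩, ρ, κ⟩ hx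
    simp only [Finset.mem_sigma, Finset.mem_filter, HasAntidiagonal.mem_antidiagonal, mem_above,
      mem_below] at hx
    obtain ⟨⟨hc, hk⟩, ⟨hs1, hc1⟩, hs2, hc2⟩ := hx
    obtain ⟨lam, hr, hu1, hu2⟩ := exists_upper hs1 hs2 c1
    have hcard := hr.card
    have hx : (⟨lam, κ⟩ : Σ _ : YoungDiagram, YoungDiagram) ∈
        (above β k).sigma fun lam => below lam c :=
      Finset.mem_sigma.2 ⟨mem_above.2 ⟨hu1, by dsimp only; omega⟩,
        mem_below.2 ⟨hu2, by dsimp only; omega⟩⟩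
    refine ⟨⟨lam, κ⟩, hx, ?_⟩
    obtain ⟨e1, e2⟩ := (hrule _ hx).eq_lower hr
    rw [e1, e2]
    obtain rfl : c2 = c - c1 := by omega
    rfl
  · intros
    rfl

/-! ### Complete homogeneous functions and Pieri's rule. -/

/-- The complete homogeneous symmetric function. -/
noncomputable def complete (k : ℕ) : MvPowerSeries ℕ ℤ := fun t => if t.degree = k then 1 else 0

theorem coeff_complete (k : ℕ) (t : ℕ →₀ ℕ) :
    MvPowerSeries.coeff t (complete k) = if t.degree = k then 1 else 0 := rfl

/-- Splitting a monomial into two factors splits the power of `x_n` and the rest independently; this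
peels the last variable off a coefficient of a product. -/
theorem sum_antidiagonal_add_single {t : ℕ →₀ ℕ} {n : ℕ} (ht : t n = 0) (c : ℕ)
    (g : (ℕ →₀ ℕ) × (ℕ →₀ ℕ) → ℤ) :
    ∑ p ∈ antidiagonal (t + Finsupp.single n c), g p = ∑ q ∈ antidiagonal c,
      ∑ p ∈ antidiagonal t, g (p.1 + Finsupp.single n q.1, p.2 + Finsupp.single n q.2) := by
  rw [← Finset.sum_product']
  symm
  have hz : ∀ p ∈ antidiagonal t, p.1 n = 0 ∧ p.2 n = 0 := fun p hp => by
    have := DFunLike.congr_fun (HasAntidiagonal.mem_antidiagonal.1 hp) n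
    rw [Finsupp.add_apply, ht] at this
    omega
  refine Finset.sum_bij' (fun x _ => (x.2.1 + Finsupp.single n x.1.1,
      x.2.2 + Finsupp.single n x.1.2))
    (fun p _ => ((p.1 n, p.2 n), (p.1.erase n, p.2.erase n))) ?_ ?_ ?_ ?_ ?_
  · rintro ⟨⟨a, b⟩, ⟨u, v⟩⟩ hx
    simp only [mem_product, HasAntidiagonal.mem_antidiagonal] at hx ⊢
    rw [← hx.1, ← hx.2, Finsupp.single_add]
    abel
  · rintro ⟨u, v⟩ hx
    simp only [mem_product, HasAntidiagonal.mem_antidiagonal] at hx ⊢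
    constructor
    · have := DFunLike.congr_fun hx n
      simpa [ht] using this
    · rw [← Finsupp.erase_add, hx, Finsupp.erase_add, Finsupp.erase_single, add_zero,
        Finsupp.erase_of_notMem_support (by simpa using ht)]
  · rintro ⟨⟨a, b⟩, ⟨u, v⟩⟩ hx
    have := hz _ (mem_product.1 hx).2
    dsimp only at this
    simp only [Finsupp.add_apply, this, Finsupp.single_eq_same, zero_add, Finsupp.erase_add,
      Finsupp.erase_single, add_zero]
    rw [Finsupp.erase_of_notMem_support (by simpa using this.1),
      Finsupp.erase_of_notMem_support (by simpa using this.2)]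
  · rintro ⟨u, v⟩ _
    simp [Finsupp.erase_add_single]
  · intros
    rfl

theorem erase_add_single_of_lt {t : ℕ →₀ ℕ} {n : ℕ} (ht : ∀ i, n + 1 ≤ i → t i = 0) :
    (∀ i, n ≤ i → t.erase n i = 0) ∧ t.erase n + Finsupp.single n (t n) = t := by
  refine ⟨fun i hi => ?_, Finsupp.erase_add_single n t⟩
  rcases hi.eq_or_lt with rfl | h
  · simp
  · rw [Finsupp.erase_ne h.ne', ht i h]

theorem coeff_schur_add_single {lam : YoungDiagram} {t : ℕ →₀ ℕ} {n : ℕ}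
    (ht : ∀ i, n ≤ i → t i = 0) (c : ℕ) :
    MvPowerSeries.coeff (t + Finsupp.single n c) (schur lam) =
      ∑ κ ∈ below lam c, MvPowerSeries.coeff t (schur κ) := by
  simp only [← kostka_bot, kostka_add_single ht]

theorem degree_eq_of_coeff_schur_ne_zero {lam : YoungDiagram} {t : ℕ →₀ ℕ}
    (h : MvPowerSeries.coeff t (schur lam) ≠ 0) : t.degree = lam.card :=
  degree_eq_of_coeff_ne_zero h

theorem kostka_zero [DecidableEq YoungDiagram] (β lam : YoungDiagram) : kostka β lam 0 = if β = lam then 1 else 0 := by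
  split_ifs with h
  · subst h
    rw [kostka_of_le le_rfl, coeff_diagramSchur, Finset.sdiff_self]
    norm_cast
    rw [Nat.card_eq_one_iff_unique]
    exact ⟨⟨fun _ _ => Subtype.ext (Subsingleton.elim _ _)⟩,
      ⟨fun _ => 0, ⟨fun p => absurd p.2 (Finset.notMem_empty _), fun p => absurd p.2 (Finset.notMem_empty _)⟩, by simp [weight]⟩⟩
  · by_contra hc
    have h1 := card_of_kostka_ne_zero hc
    have h2 := le_of_kostka_ne_zero hc
    refine h (cells_injective (Finset.eq_of_subset_of_card_le
      (YoungDiagram.cells_subset_iff.2 h2) ?_))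
    simp only [map_zero, add_zero] at h1
    exact h1.le

/-- Pieri's rule. -/
theorem complete_mul_schur (k : ℕ) (β : YoungDiagram) :
    complete k * schur β = ∑ lam ∈ above β k, schur lam := by
  have : DecidableEq YoungDiagram := Classical.decEq _
  -- Induction on the number of variables allowed in `t`; `k` and `β` vary because removing the last
  -- variable changes both.
  have key : ∀ (n : ℕ) (t : ℕ →₀ ℕ), (∀ i, n ≤ i → t i = 0) → ∀ (k : ℕ) (β : YoungDiagram),
      MvPowerSeries.coeff t (complete k * schur β) =
        ∑ lam ∈ above β k, MvPowerSeries.coeff t (schur lam) := by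
    intro n
    induction n with
    | zero =>
      intro t ht k β
      obtain rfl : t = 0 := Finsupp.ext fun i => ht i (Nat.zero_le i)
      rw [MvPowerSeries.coeff_mul]
      simp only [Finsupp.antidiagonal_zero, Finset.sum_singleton, coeff_complete, map_zero,
        ← kostka_bot, kostka_zero]
      by_cases h : 0 = k ∧ ⊥ = β
      · obtain ⟨rfl, rfl⟩ := h
        rw [if_pos rfl, if_pos rfl, Finset.sum_ite_eq, if_pos]; · rfl
        exact mem_above.2 ⟨⟨le_rfl, fun i j h => absurd h (YoungDiagram.notMem_bot _)⟩, rfl⟩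
      · rw [Finset.sum_ite_eq, if_neg (c := ⊥ ∈ above β k)]
        · split_ifs <;> simp_all
        · intro h2
          have h3 := mem_above.1 h2
          refine h ⟨?_, (le_bot_iff.1 h3.1.1).symm⟩
          have : (⊥ : YoungDiagram).card = 0 := rfl
          omega
    | succ n ih =>
      intro t ht k β
      obtain ⟨h1, h2⟩ := erase_add_single_of_lt ht
      generalize t.erase n = u at h1 h2
      generalize t n = c at h2
      subst h2
      simp_rw [coeff_schur_add_single h1]
      -- Branching has produced "add a strip, then remove one" from the Schur side. The local rule
      -- makes it "remove, then add", which matches the product once `x_n` is distributed over its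
      -- two factors.
      rw [sum_above_below, MvPowerSeries.coeff_mul, sum_antidiagonal_add_single (h1 n le_rfl)]
      refine Finset.sum_congr rfl fun q _ => ?_
      dsimp only
      have h3 : ∀ p ∈ antidiagonal u,
          MvPowerSeries.coeff (p.1 + Finsupp.single n q.1) (complete k) *
            MvPowerSeries.coeff (p.2 + Finsupp.single n q.2) (schur β) =
          if q.1 ≤ k then ∑ ρ ∈ below β q.2, MvPowerSeries.coeff p.1 (complete (k - q.1)) *
            MvPowerSeries.coeff p.2 (schur ρ) else 0 := by
        intro p hp
        rw [coeff_schur_add_single, coeff_complete, map_add, Finsupp.degree_single]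
        · split_ifs with h4 h5 h5
          · rw [one_mul]
            refine Finset.sum_congr rfl fun ρ _ => ?_
            rw [coeff_complete, if_pos (by omega), one_mul]
          · omega
          · rw [zero_mul]
            refine (Finset.sum_eq_zero fun ρ _ => ?_).symm
            rw [coeff_complete, if_neg (by omega), zero_mul]
          · rw [zero_mul]
        · intro i hi
          have := DFunLike.congr_fun (HasAntidiagonal.mem_antidiagonal.1 hp) i
          rw [Finsupp.add_apply, h1 i hi] at this
          omega
      rw [Finset.sum_congr rfl h3]
      split_ifs with h4
      · rw [Finset.sum_comm]
        refine Finset.sum_congr rfl fun ρ _ => ?_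
        rw [← ih u h1, MvPowerSeries.coeff_mul]
      · simp
  ext t
  rw [map_sum]
  refine key (t.support.sup id + 1) t (fun i hi => ?_) k β
  by_contra hc
  have := Finset.le_sup (f := id) (Finsupp.mem_support_iff.2 hc)
  simp only [id] at this
  omega

/-- Iterated Pieri adds strips of sizes `t 0, t 1, …` to `β`; such chains ending at `lam` are the
tableaux of shape `lam / β` and weight `t`. Here `t` need not be decreasing, so symmetry of Schur
functions is never needed. -/
theorem prod_complete_mul_schur (β : YoungDiagram) : ∀ (n : ℕ) (t : ℕ →₀ ℕ),
    (∀ i, n ≤ i → t i = 0) → (∏ i ∈ range n, complete (t i)) * schur β =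
      ∑ lam ∈ ofSize (β.card + t.degree), kostka β lam t • schur lam := by
  have : DecidableEq YoungDiagram := Classical.decEq _
  intro n
  induction n with
  | zero =>
    intro t ht
    obtain rfl : t = 0 := Finsupp.ext fun i => ht i (Nat.zero_le i)
    simp [kostka_zero]
  | succ n ih =>
    intro t ht
    obtain ⟨h1, h2⟩ := erase_add_single_of_lt ht
    have h3 : ∏ i ∈ range n, complete (t i) = ∏ i ∈ range n, complete (t.erase n i) :=
      Finset.prod_congr rfl fun i hi => by rw [Finsupp.erase_ne (mem_range.1 hi).ne]
    rw [Finset.prod_range_succ, h3]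
    generalize t.erase n = u at h1 h2
    generalize t n = c at h2
    subst h2
    rw [mul_comm _ (complete c), mul_assoc, ih u h1, Finset.mul_sum]
    simp_rw [mul_smul_comm, complete_mul_schur, kostka_add_single h1, Finset.smul_sum,
      Finset.sum_smul]
    refine Finset.sum_comm' fun κ lam => ?_
    rw [mem_ofSize, mem_ofSize, mem_above, mem_below, map_add, Finsupp.degree_single]
    constructor
    · rintro ⟨a, b, d⟩
      exact ⟨⟨b, by omega⟩, by omega⟩
    · rintro ⟨⟨a, b⟩, d⟩
      exact ⟨by omega, a, by omega⟩

/-- Each horizontal strip lets row `i + 1` grow at most to the previous length of row `i`. -/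
theorem rowLen_add_le_of_kostka_ne_zero {β : YoungDiagram} : ∀ (n : ℕ) (t : ℕ →₀ ℕ),
    (∀ i, n ≤ i → t i = 0) → ∀ lam, kostka β lam t ≠ 0 →
      ∀ i, lam.rowLen (i + n) ≤ β.rowLen i := by
  have : DecidableEq YoungDiagram := Classical.decEq _
  intro n
  induction n with
  | zero =>
    intro t ht lam h i
    obtain rfl : t = 0 := Finsupp.ext fun i => ht i (Nat.zero_le i)
    rw [kostka_zero] at h
    obtain rfl : β = lam := by
      by_contra hc
      exact h (if_neg hc)
    exact le_rfl
  | succ n ih =>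
    intro t ht lam h i
    obtain ⟨h1, h2⟩ := erase_add_single_of_lt ht
    rw [← h2, kostka_add_single h1] at h
    obtain ⟨κ, hκ, hne⟩ := Finset.exists_ne_zero_of_sum_ne_zero h
    exact ((isHorizontalStrip_iff.1 (mem_below.1 hκ).1).2 (i + n)).trans (ih _ h1 κ hne i)

/-! ### Unitriangularity and linear independence. -/

/-- The exponent vector of the row lengths of `α`. -/
noncomputable def rowWeight (α : YoungDiagram) : ℕ →₀ ℕ := weight α.cells fun p => p.1.1

theorem rowWeight_apply (α : YoungDiagram) (i : ℕ) : rowWeight α i = α.rowLen i := by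
  rw [rowWeight, weight_restrict α.cells fun p => p.1, Finsupp.finsetSum_apply,
    YoungDiagram.rowLen_eq_card, YoungDiagram.row, Finset.card_filter]
  exact Finset.sum_congr rfl fun p _ => Finsupp.single_apply

theorem rowWeight_injective : Function.Injective rowWeight := fun α β h =>
  eq_of_rowLen fun i => by rw [← rowWeight_apply, ← rowWeight_apply, h]

theorem degree_rowWeight (α : YoungDiagram) : (rowWeight α).degree = α.card :=
  degree_weight _ _

theorem rowLen_eq_zero_of_colLen_le {α : YoungDiagram} {i : ℕ} (h : α.colLen 0 ≤ i) :
    α.rowLen i = 0 := by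
  by_contra hc
  have h1 := YoungDiagram.mem_iff_lt_colLen.1
    (YoungDiagram.mem_iff_lt_rowLen.2 (Nat.pos_of_ne_zero hc))
  omega

theorem rowWeight_eq_zero {α : YoungDiagram} {n : ℕ} (h : α.colLen 0 ≤ n) :
    ∀ i, n ≤ i → rowWeight α i = 0 := fun i hi => by
  rw [rowWeight_apply, rowLen_eq_zero_of_colLen_le (h.trans hi)]

/-- The sum of the row indices of the cells. -/
def rowIndexSum (α : YoungDiagram) : ℕ := ∑ p : α.cells, p.1.1

theorem sum_filling (D : Finset (ℕ × ℕ)) (T : D → ℕ) :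
    Finsupp.linearCombination ℕ (id : ℕ → ℕ) (weight D T) = ∑ p, T p := by
  simp [weight, map_sum]

theorem row_le_filling {α : YoungDiagram} {T : α.cells → ℕ} (hT : IsSemistandard _ T) :
    ∀ p : α.cells, p.1.1 ≤ T p := by
  rintro ⟨⟨i, j⟩, hp⟩
  induction i with
  | zero => exact Nat.zero_le _
  | succ i ih =>
    have hq : (i, j) ∈ α.cells := α.up_left_mem (Nat.le_succ i) le_rfl hp
    exact (ih hq).trans_lt (hT.col_strict ⟨_, hq⟩ ⟨_, hp⟩ rfl (Nat.lt_succ_self i))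

theorem filling_eq_row {α κ : YoungDiagram} {T : α.cells → ℕ} (hT : IsSemistandard _ T)
    (hw : weight _ T = rowWeight κ) :
    rowIndexSum α ≤ rowIndexSum κ ∧
      (rowIndexSum α = rowIndexSum κ → T = fun p => p.1.1) := by
  have h1 : rowIndexSum κ = ∑ p, T p := by
    rw [← sum_filling, hw, rowWeight, sum_filling, rowIndexSum]
  have h2 := row_le_filling hT
  rw [h1]
  refine ⟨Finset.sum_le_sum fun p _ => h2 p, fun h => ?_⟩
  funext p
  exact ((Finset.sum_eq_sum_iff_of_le fun p _ => h2 p).1 h p (Finset.mem_univ p)).symm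

/-- Labels are at least their row index, and the sum of the labels depends only on the weight. Thus
`rowIndexSum` can replace dominance order; equality forces the filling by row indices. -/
theorem triangular {α κ : YoungDiagram}
    (h : MvPowerSeries.coeff (rowWeight κ) (schur α) ≠ 0) :
    (α = κ ∨ rowIndexSum α < rowIndexSum κ) ∧ α.colLen 0 ≤ κ.colLen 0 := by
  obtain ⟨T, hT, hw⟩ := exists_filling_of_coeff_ne_zero h
  obtain ⟨h1, h2⟩ := filling_eq_row hT hw
  refine ⟨?_, ?_⟩
  · rcases h1.eq_or_lt with h3 | h3
    · left
      rw [h2 h3] at hw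
      exact rowWeight_injective hw
    · exact Or.inr h3
  · by_contra hc
    have hp : (κ.colLen 0, 0) ∈ α.cells := YoungDiagram.mem_iff_lt_colLen.2 (not_le.1 hc)
    have h3 : κ.colLen 0 ≤ T ⟨_, hp⟩ := row_le_filling hT ⟨_, hp⟩
    refine weight_apply_ne_zero _ T ⟨_, hp⟩ ?_
    rw [hw, rowWeight_eq_zero h3 _ le_rfl]

theorem coeff_rowWeight_self (α : YoungDiagram) :
    MvPowerSeries.coeff (rowWeight α) (schur α) = 1 := by
  rw [schur, coeff_diagramSchur]
  norm_cast
  rw [Nat.card_eq_one_iff_unique]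
  refine ⟨⟨fun T T' => Subtype.ext ?_⟩, ⟨fun p => p.1.1, ⟨fun p q h _ => h.le, fun p q _ h => h⟩,
    rfl⟩⟩
  rw [(filling_eq_row T.2.1 T.2.2).2 rfl, (filling_eq_row T'.2.1 T'.2.2).2 rfl]

/-- In a relation, take a shape `α` of least `rowIndexSum`: the monomial `rowWeight α` sees no other
shape. -/
theorem linearIndependent_schur : LinearIndependent ℤ schur := by
  rw [linearIndependent_iff]
  intro c hc
  by_contra hne
  obtain ⟨α, hα, hmin⟩ := Finset.exists_min_image c.support rowIndexSum
    (Finsupp.support_nonempty_iff.2 hne)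
  have h := congrArg (MvPowerSeries.coeff (rowWeight α)) hc
  rw [Finsupp.linearCombination_apply, Finsupp.sum, map_sum, map_zero,
    Finset.sum_eq_single α] at h
  · rw [map_smul, coeff_rowWeight_self, smul_eq_mul, mul_one] at h
    exact Finsupp.mem_support_iff.1 hα h
  · intro κ hκ hne
    rw [map_smul, smul_eq_mul, mul_eq_zero]
    right
    by_contra h3
    rcases (triangular h3).1 with h4 | h4
    · exact hne h4
    · exact absurd (hmin κ hκ) (not_le.2 h4)
  · exact fun h => absurd hα h

/-! ### Schur functions in terms of complete functions, and products of Schur functions. -/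

theorem schur_bot : schur ⊥ = 1 := by
  have : DecidableEq YoungDiagram := Classical.decEq _
  ext t
  rw [MvPowerSeries.coeff_one]
  split_ifs with ht
  · rw [ht, ← kostka_bot, kostka_zero, if_pos rfl]
  · by_contra hc
    have := degree_eq_of_coeff_schur_ne_zero hc
    exact ht ((Finsupp.degree_eq_zero_iff t).1 this)

theorem prod_complete (n : ℕ) (t : ℕ →₀ ℕ) (ht : ∀ i, n ≤ i → t i = 0) :
    ∏ i ∈ range n, complete (t i) =
      ∑ lam ∈ ofSize t.degree, MvPowerSeries.coeff t (schur lam) • schur lam := by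
  have h := prod_complete_mul_schur ⊥ n t ht
  have h0 : (⊥ : YoungDiagram).card = 0 := rfl
  simpa only [schur_bot, mul_one, kostka_bot, h0, zero_add] using h

/-- Inverts the unitriangular expansion of `prod_complete`. The bound on the number of factors is
kept, as it controls the rows of the shapes in a product. -/
theorem schur_mem_span_prod_complete (α : YoungDiagram) :
    schur α ∈ Submodule.span ℤ {f | ∃ κ : YoungDiagram, κ.card = α.card ∧
      κ.colLen 0 ≤ α.colLen 0 ∧ f = ∏ i ∈ range (α.colLen 0), complete (rowWeight κ i)} := by
  classical
  -- The number `n` of factors is decoupled from `ℓ(α)`: the shapes met in the induction may have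
  -- fewer rows, and the surplus factors are `complete 0`.
  suffices H : ∀ (N : ℕ) (α : YoungDiagram), rowIndexSum α = N → ∀ n, α.colLen 0 ≤ n →
      schur α ∈ Submodule.span ℤ {f | ∃ κ : YoungDiagram, κ.card = α.card ∧
        κ.colLen 0 ≤ n ∧ f = ∏ i ∈ range n, complete (rowWeight κ i)} from
    H _ α rfl _ le_rfl
  intro N
  induction N using Nat.strong_induction_on with
  | _ N ih =>
    intro α hN n hn
    have h := prod_complete n (rowWeight α) (rowWeight_eq_zero hn)
    rw [degree_rowWeight, ← Finset.add_sum_erase _ _ (mem_ofSize.2 (rfl : α.card = α.card)),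
      coeff_rowWeight_self, one_smul] at h
    rw [eq_sub_of_add_eq h.symm]
    refine Submodule.sub_mem _ (Submodule.subset_span ⟨α, rfl, hn, rfl⟩)
      (Submodule.sum_mem _ fun κ hκ => ?_)
    by_cases h0 : MvPowerSeries.coeff (rowWeight α) (schur κ) = 0
    · rw [h0, zero_smul]
      exact Submodule.zero_mem _
    · obtain ⟨h1, h2⟩ := triangular h0
      have h3 := h1.resolve_left (Finset.mem_erase.1 hκ).1
      have h4 := mem_ofSize.1 (Finset.mem_erase.1 hκ).2
      have := ih _ (hN ▸ h3) κ rfl n (h2.trans hn)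
      rw [h4] at this
      exact Submodule.smul_mem _ _ this

/-- The Schur functions occurring in a product. -/
theorem schur_mul_schur_mem_span (α β : YoungDiagram) :
    schur α * schur β ∈ Submodule.span ℤ (schur '' {lam | β ≤ lam ∧ lam.card = α.card + β.card ∧
      ∀ i, lam.rowLen (i + α.colLen 0) ≤ β.rowLen i}) := by
  -- It suffices to multiply `s_β` by products of `ℓ(α)` complete functions of total degree `|α|`,
  -- that is, to add `ℓ(α)` horizontal strips.
  have h := schur_mem_span_prod_complete α
  generalize schur α = f at h
  induction h using Submodule.span_induction with
  | mem f hf =>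
    obtain ⟨κ, h1, h2, rfl⟩ := hf
    rw [prod_complete_mul_schur β _ _ (rowWeight_eq_zero h2)]
    refine Submodule.sum_mem _ fun lam hlam => ?_
    by_cases h0 : kostka β lam (rowWeight κ) = 0
    · rw [h0, zero_smul]
      exact Submodule.zero_mem _
    · refine Submodule.smul_mem _ _ (Submodule.subset_span ⟨lam, ⟨le_of_kostka_ne_zero h0, ?_,
        rowLen_add_le_of_kostka_ne_zero _ _ (rowWeight_eq_zero h2) lam h0⟩, rfl⟩)
      rw [mem_ofSize, degree_rowWeight, h1] at hlam
      omega
  | zero =>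
    rw [zero_mul]
    exact Submodule.zero_mem _
  | add f g _ _ hf hg =>
    rw [add_mul]
    exact Submodule.add_mem _ hf hg
  | smul a f _ hf =>
    rw [smul_mul_assoc]
    exact Submodule.smul_mem _ _ hf

/-! ### Schur expansions, their coefficients and the Hall product. -/

theorem hasSchurExpansion_iff {f : MvPowerSeries ℕ ℤ} :
    HasSchurExpansion f ↔ f ∈ Submodule.span ℤ (Set.range schur) := by
  rw [Finsupp.mem_span_range_iff_exists_finsupp]
  constructor
  · rintro ⟨c, hc, -⟩
    exact ⟨c, hc⟩
  · rintro ⟨c, hc⟩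
    exact ⟨c, hc, fun c' hc' => linearIndependent_schur
      (hc'.trans ((Finsupp.linearCombination_apply ℤ c).trans hc).symm)⟩

theorem linearCombination_schurExpansion {f : MvPowerSeries ℕ ℤ} (h : HasSchurExpansion f) :
    Finsupp.linearCombination ℤ schur (schurExpansion f) = f := by
  rw [schurExpansion, dif_pos h]
  exact h.choose_spec.1

theorem schurExpansion_linearCombination (c : YoungDiagram →₀ ℤ) :
    schurExpansion (Finsupp.linearCombination ℤ schur c) = c := by
  apply linearIndependent_schur
  refine linearCombination_schurExpansion (hasSchurExpansion_iff.2 ?_)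
  rw [Finsupp.range_linearCombination ℤ |>.symm]
  exact ⟨c, rfl⟩

theorem hasSchurExpansion_schur (lam : YoungDiagram) : HasSchurExpansion (schur lam) :=
  hasSchurExpansion_iff.2 (Submodule.subset_span ⟨lam, rfl⟩)

theorem schurExpansion_schur (lam : YoungDiagram) :
    schurExpansion (schur lam) = Finsupp.single lam 1 := by
  have h := schurExpansion_linearCombination (Finsupp.single lam 1)
  rwa [Finsupp.linearCombination_single, one_smul] at h

theorem hallInner_schur (lam : YoungDiagram) (f : MvPowerSeries ℕ ℤ) :
    hallInner (schur lam) f = schurCoeff lam f := by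
  rw [hallInner, schurExpansion_schur, Finsupp.sum_single_index (by simp), one_mul, schurCoeff]

theorem HasSchurExpansion.sub {f g : MvPowerSeries ℕ ℤ} (hf : HasSchurExpansion f)
    (hg : HasSchurExpansion g) : HasSchurExpansion (f - g) := by
  rw [hasSchurExpansion_iff] at *
  exact Submodule.sub_mem _ hf hg

theorem schurCoeff_sub {f g : MvPowerSeries ℕ ℤ} (hf : HasSchurExpansion f)
    (hg : HasSchurExpansion g) (lam : YoungDiagram) :
    schurCoeff lam (f - g) = schurCoeff lam f - schurCoeff lam g := by
  have h := schurExpansion_linearCombination (schurExpansion f - schurExpansion g)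
  rw [map_sub, linearCombination_schurExpansion hf, linearCombination_schurExpansion hg] at h
  rw [schurCoeff, h, Finsupp.sub_apply, schurCoeff, schurCoeff]

theorem schurCoeff_sum {ι : Type*} (s : Finset ι) (a : ι → ℤ) (f : ι → MvPowerSeries ℕ ℤ)
    (hf : ∀ i ∈ s, HasSchurExpansion (f i)) (lam : YoungDiagram) :
    schurCoeff lam (∑ i ∈ s, a i • f i) = ∑ i ∈ s, a i * schurCoeff lam (f i) := by
  have h := schurExpansion_linearCombination (∑ i ∈ s, a i • schurExpansion (f i))
  rw [map_sum, Finset.sum_congr rfl (g := fun i => a i • f i) fun i hi => by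
    rw [map_smul, linearCombination_schurExpansion (hf i hi)]] at h
  rw [schurCoeff, h, Finsupp.finsetSum_apply]
  rfl

theorem schurCoeff_sum_schur (s : Finset YoungDiagram) (a : YoungDiagram → ℤ)
    {lam : YoungDiagram} (h : lam ∈ s) : schurCoeff lam (∑ κ ∈ s, a κ • schur κ) = a lam := by
  rw [schurCoeff_sum s a schur (fun κ _ => hasSchurExpansion_schur κ), Finset.sum_eq_single lam]
  · rw [schurCoeff, schurExpansion_schur, Finsupp.single_eq_same, mul_one]
  · intro κ _ hne
    rw [schurCoeff, schurExpansion_schur, Finsupp.single_eq_of_ne hne.symm, mul_zero]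
  · exact fun h' => absurd h h'

theorem schurCoeff_eq_zero {f : MvPowerSeries ℕ ℤ} {S : Set YoungDiagram} {lam : YoungDiagram}
    (hf : f ∈ Submodule.span ℤ (schur '' S)) (h : lam ∉ S) : schurCoeff lam f = 0 := by
  obtain ⟨c, hc, rfl⟩ := (Finsupp.mem_span_image_iff_linearCombination ℤ).1 hf
  rw [schurCoeff, schurExpansion_linearCombination]
  by_contra hne
  exact h ((Finsupp.mem_supported ℤ c).1 hc (Finsupp.mem_support_iff.2 hne))

theorem HasSchurExpansion.mul {f g : MvPowerSeries ℕ ℤ} (hf : HasSchurExpansion f)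
    (hg : HasSchurExpansion g) : HasSchurExpansion (f * g) := by
  rw [hasSchurExpansion_iff] at *
  refine Submodule.span_induction₂ (p := fun f g _ _ => f * g ∈ _) ?_ ?_ ?_ ?_ ?_ ?_ ?_ hf hg
  · rintro _ _ ⟨α, rfl⟩ ⟨β, rfl⟩
    exact Submodule.span_mono (Set.image_subset_range _ _) (schur_mul_schur_mem_span α β)
  · intro y _
    rw [zero_mul]
    exact Submodule.zero_mem _
  · intro y _
    rw [mul_zero]
    exact Submodule.zero_mem _
  · intro x y z _ _ _ h1 h2
    rw [add_mul]
    exact Submodule.add_mem _ h1 h2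
  · intro x y z _ _ _ h1 h2
    rw [mul_add]
    exact Submodule.add_mem _ h1 h2
  · intro r x y _ _ h
    rw [smul_mul_assoc]
    exact Submodule.smul_mem _ _ h
  · intro r x y _ _ h
    rw [mul_smul_comm]
    exact Submodule.smul_mem _ _ h

/-! ### Adjointness of multiplication and skewing. -/

/-- Multiplication by `s_β` is adjoint to the passage from `s_lam` to `s_{lam / β}`. -/
theorem diagramSchur_sdiff {β lam : YoungDiagram} (h : β ≤ lam) :
    diagramSchur (lam.cells \ β.cells) = ∑ α ∈ ofSize (lam.cells \ β.cells).card,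
      schurCoeff lam (schur α * schur β) • schur α := by
  have hcard := card_sdiff_add h
  generalize hn : (lam.cells \ β.cells).card = n at hcard
  ext t
  by_cases ht : t.degree = n
  · have hN : ∃ N, ∀ i, N ≤ i → t i = 0 := by
      refine ⟨t.support.sup id + 1, fun i hi => ?_⟩
      by_contra hc
      have := Finset.le_sup (f := id) (Finsupp.mem_support_iff.2 hc)
      simp only [id] at this
      omega
    obtain ⟨N, hN⟩ := hN
    -- Expand `h_t s_β` in two ways, directly by Pieri and through `h_t = ∑ K_{α,t} s_α`. The
    -- coefficient of `s_lam` gives the identity at the monomial `t`.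
    have h1 := prod_complete_mul_schur β N t hN
    rw [prod_complete N t hN, Finset.sum_mul] at h1
    simp_rw [smul_mul_assoc] at h1
    have h2 := congrArg (schurCoeff lam) h1
    rw [schurCoeff_sum_schur _ _ (mem_ofSize.2 (by omega)), schurCoeff_sum _ _ _
      (fun α _ => (hasSchurExpansion_schur α).mul (hasSchurExpansion_schur β)),
      kostka_of_le h, ht] at h2
    rw [← h2, map_sum]
    refine Finset.sum_congr rfl fun α _ => ?_
    rw [map_smul, smul_eq_mul, mul_comm]
  · rw [map_sum, Finset.sum_eq_zero]
    · by_contra hc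
      exact ht ((degree_eq_of_coeff_ne_zero hc).trans hn)
    · intro α hα
      rw [map_smul, smul_eq_mul, mul_eq_zero]
      right
      by_contra hc
      exact ht ((degree_eq_of_coeff_schur_ne_zero hc).trans (mem_ofSize.1 hα))

theorem hasSchurExpansion_sdiff {β lam : YoungDiagram} (h : β ≤ lam) :
    HasSchurExpansion (diagramSchur (lam.cells \ β.cells)) := by
  rw [hasSchurExpansion_iff, diagramSchur_sdiff h]
  exact Submodule.sum_mem _ fun α _ =>
    Submodule.smul_mem _ _ (Submodule.subset_span ⟨α, rfl⟩)

theorem schurCoeff_mul_eq {α β lam : YoungDiagram} (h : β ≤ lam)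
    (hcard : (lam.cells \ β.cells).card = α.card) :
    schurCoeff lam (schur α * schur β) =
      schurCoeff α (diagramSchur (lam.cells \ β.cells)) := by
  rw [diagramSchur_sdiff h, schurCoeff_sum_schur _ _ (mem_ofSize.2 hcard.symm)]

/-- The shapes occurring in a multiple of `s_γ` contain `γ`. -/
theorem schurCoeff_schur_mul_eq_zero {γ lam : YoungDiagram} {f : MvPowerSeries ℕ ℤ}
    (hf : HasSchurExpansion f) (h : ¬ γ ≤ lam) : schurCoeff lam (schur γ * f) = 0 := by
  refine schurCoeff_eq_zero (S := {lam | γ ≤ lam}) ?_ h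
  rw [hasSchurExpansion_iff] at hf
  induction hf using Submodule.span_induction with
  | mem f hf =>
    obtain ⟨κ, rfl⟩ := hf
    rw [mul_comm]
    exact Submodule.span_mono (Set.image_mono fun lam h => h.1) (schur_mul_schur_mem_span κ γ)
  | zero =>
    rw [mul_zero]
    exact Submodule.zero_mem _
  | add f g _ _ hf hg =>
    rw [mul_add]
    exact Submodule.add_mem _ hf hg
  | smul a f _ hf =>
    rw [mul_smul_comm]
    exact Submodule.smul_mem _ _ hf

/-! ### Translated diagrams and disconnected unions. -/

/-- The diagram `D` moved down by `a` rows and right by `b` columns. -/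
def shift (a b : ℕ) (D : Finset (ℕ × ℕ)) : Finset (ℕ × ℕ) := D.image fun p => (p.1 + a, p.2 + b)

theorem shift_injective (a b : ℕ) : Function.Injective fun p : ℕ × ℕ => (p.1 + a, p.2 + b) := by
  rintro ⟨i, j⟩ ⟨i', j'⟩ h
  simpa using h

theorem card_shift (a b : ℕ) (D : Finset (ℕ × ℕ)) : (shift a b D).card = D.card :=
  Finset.card_image_of_injective _ (shift_injective a b)

theorem mem_shift {a b i j : ℕ} {D : Finset (ℕ × ℕ)} :
    (i, j) ∈ shift a b D ↔ a ≤ i ∧ b ≤ j ∧ (i - a, j - b) ∈ D := by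
  simp only [shift, mem_image, Prod.mk.injEq, Prod.exists]
  constructor
  · rintro ⟨x, y, h, rfl, rfl⟩
    simpa using h
  · rintro ⟨h1, h2, h3⟩
    exact ⟨_, _, h3, by omega, by omega⟩

theorem diagramSchur_shift (a b : ℕ) (D : Finset (ℕ × ℕ)) :
    diagramSchur (shift a b D) = diagramSchur D := by
  let e : D ≃ shift a b D := Equiv.ofBijective
    (fun p => ⟨(p.1.1 + a, p.1.2 + b), Finset.mem_image_of_mem _ p.2⟩)
    ⟨fun p q h => Subtype.ext (shift_injective a b (congrArg Subtype.val h)), fun q => by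
      obtain ⟨p, hp, h⟩ := Finset.mem_image.1 q.2
      exact ⟨⟨p, hp⟩, Subtype.ext h⟩⟩
  have he : ∀ p, (e p).1 = (p.1.1 + a, p.1.2 + b) := fun _ => rfl
  ext t
  rw [coeff_diagramSchur, coeff_diagramSchur]
  congr 1
  refine Nat.card_congr ((Equiv.arrowCongr e.symm (Equiv.refl ℕ)).subtypeEquiv fun T => ?_)
  have hT : (Equiv.arrowCongr e.symm (Equiv.refl ℕ)) T = fun p => T (e p) := rfl
  rw [hT]
  refine and_congr ⟨fun h => ⟨fun p q h1 h2 => ?_, fun p q h1 h2 => ?_⟩,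
    fun h => ⟨fun p q h1 h2 => ?_, fun p q h1 h2 => ?_⟩⟩ ?_
  · exact h.row_weak _ _ (by simp [he, h1]) (by simpa [he] using h2)
  · exact h.col_strict _ _ (by simp [he, h1]) (by simpa [he] using h2)
  · obtain ⟨p, rfl⟩ := e.surjective p
    obtain ⟨q, rfl⟩ := e.surjective q
    exact h.row_weak p q (by simpa [he] using h1) (by simpa [he] using h2)
  · obtain ⟨p, rfl⟩ := e.surjective p
    obtain ⟨q, rfl⟩ := e.surjective q
    exact h.col_strict p q (by simpa [he] using h1) (by simpa [he] using h2)
  · rw [weight, weight, e.sum_comp fun q => Finsupp.single (T q) 1]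

/-- The Schur function of a disconnected union. -/
theorem diagramSchur_union {A B : Finset (ℕ × ℕ)}
    (h : ∀ p ∈ A, ∀ q ∈ B, p.1 ≠ q.1 ∧ p.2 ≠ q.2) :
    diagramSchur (A ∪ B) = diagramSchur A * diagramSchur B := by
  classical
  have hdisj : Disjoint A B := Finset.disjoint_left.2 fun p hA hB => (h p hA p hB).1 rfl
  ext t
  have := fun u => finite_fillings A u
  have := fun u => finite_fillings B u
  have hrhs : MvPowerSeries.coeff t (diagramSchur A * diagramSchur B) =
      ((∑ x : ↥(antidiagonal t), Nat.card
        ({T : A → ℕ // IsSemistandard A T ∧ weight A T = x.1.1} ×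
          {T : B → ℕ // IsSemistandard B T ∧ weight B T = x.1.2}) : ℕ) : ℤ) := by
    rw [MvPowerSeries.coeff_mul, Finset.sum_coe_sort (antidiagonal t) (fun x => Nat.card
        ({T : A → ℕ // IsSemistandard A T ∧ weight A T = x.1} ×
          {T : B → ℕ // IsSemistandard B T ∧ weight B T = x.2}))]
    push_cast
    exact Finset.sum_congr rfl fun x _ => by
      rw [coeff_diagramSchur, coeff_diagramSchur, Nat.card_prod, Nat.cast_mul]
  rw [hrhs, coeff_diagramSchur, ← Nat.card_sigma]
  congr 1
  symm
  -- The default `0` is never taken, since every cell of the union is in `A` or in `B`.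
  let glue : (A → ℕ) → (B → ℕ) → ↥(A ∪ B) → ℕ := fun S T p =>
    if hA : p.1 ∈ A then S ⟨p.1, hA⟩ else
      if hB : p.1 ∈ B then T ⟨p.1, hB⟩ else 0
  have hmA : ∀ p : A, p.1 ∈ A ∪ B := fun p => mem_union_left _ p.2
  have hmB : ∀ p : B, p.1 ∈ A ∪ B := fun p => mem_union_right _ p.2
  have gA : ∀ S T (p : A), glue S T ⟨p.1, hmA p⟩ = S p := fun S T p => dif_pos p.2
  have gB : ∀ S T (p : B), glue S T ⟨p.1, hmB p⟩ = T p := fun S T p => by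
    have hn : p.1 ∉ A := fun hA => Finset.disjoint_left.1 hdisj hA p.2
    simp only [glue, dif_neg hn, dif_pos p.2]
  have hcases : ∀ p : ↥(A ∪ B), (∃ q : A, p = ⟨q.1, hmA q⟩) ∨ ∃ q : B, p = ⟨q.1, hmB q⟩ :=
    fun p => (mem_union.1 p.2).imp (fun hp => ⟨⟨p.1, hp⟩, rfl⟩) fun hp => ⟨⟨p.1, hp⟩, rfl⟩
  have hw : ∀ T : ↥(A ∪ B) → ℕ, weight _ T =
      weight A (fun p => T ⟨p.1, hmA p⟩) + weight B fun p => T ⟨p.1, hmB p⟩ := by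
    intro T
    let g : ℕ × ℕ → ℕ := fun p => if hp : p ∈ A ∪ B then T ⟨p, hp⟩ else 0
    have hg : ∀ p (hp : p ∈ A ∪ B), g p = T ⟨p, hp⟩ := fun p hp => dif_pos hp
    have h1 : T = fun p : ↥(A ∪ B) => g p.1 := funext fun p => (hg p.1 p.2).symm
    have h2 : (fun p : A => T ⟨p.1, hmA p⟩) = fun p => g p.1 := funext fun p => (hg _ _).symm
    have h3 : (fun p : B => T ⟨p.1, hmB p⟩) = fun p => g p.1 := funext fun p => (hg _ _).symm
    rw [h2, h3, congrArg (weight _) h1, weight_restrict, weight_restrict, weight_restrict,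
      Finset.sum_union hdisj]
  have key : ∀ x : Σ x : ↥(antidiagonal t),
      {T : A → ℕ // IsSemistandard A T ∧ weight A T = x.1.1} ×
        {T : B → ℕ // IsSemistandard B T ∧ weight B T = x.1.2},
      IsSemistandard _ (glue x.2.1.1 x.2.2.1) ∧ weight _ (glue x.2.1.1 x.2.2.1) = t := by
    rintro ⟨x, ⟨S, hS, hwS⟩, ⟨T, hT, hwT⟩⟩
    dsimp only
    refine ⟨⟨fun p q h1 h2 => ?_, fun p q h1 h2 => ?_⟩, ?_⟩
    · rcases hcases p with ⟨p, rfl⟩ | ⟨p, rfl⟩ <;> rcases hcases q with ⟨q, rfl⟩ | ⟨q, rfl⟩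
      · rw [gA, gA]
        exact hS.row_weak p q h1 h2
      · exact absurd h1 (h _ p.2 _ q.2).1
      · exact absurd h1.symm (h _ q.2 _ p.2).1
      · rw [gB, gB]
        exact hT.row_weak p q h1 h2
    · rcases hcases p with ⟨p, rfl⟩ | ⟨p, rfl⟩ <;> rcases hcases q with ⟨q, rfl⟩ | ⟨q, rfl⟩
      · rw [gA, gA]
        exact hS.col_strict p q h1 h2
      · exact absurd h1 (h _ p.2 _ q.2).2
      · exact absurd h1.symm (h _ q.2 _ p.2).2
      · rw [gB, gB]
        exact hT.col_strict p q h1 h2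
    · rw [hw]
      simp_rw [gA, gB]
      rw [hwS, hwT]
      exact HasAntidiagonal.mem_antidiagonal.1 x.2
  refine Nat.card_eq_of_bijective (fun x => ⟨glue x.2.1.1 x.2.2.1, key x⟩) ⟨?_, ?_⟩
  · rintro ⟨⟨⟨u, v⟩, hx⟩, ⟨S, hS, hwS⟩, ⟨T, hT, hwT⟩⟩ ⟨⟨⟨u', v'⟩, hx'⟩, ⟨S', hS', hwS'⟩,
      ⟨T', hT', hwT'⟩⟩ he
    have he' : glue S T = glue S' T' := congrArg Subtype.val he
    obtain rfl : S = S' := funext fun p => by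
      rw [← gA S T, he', gA]
    obtain rfl : T = T' := funext fun p => by
      rw [← gB S T, he', gB]
    obtain rfl : u = u' := hwS.symm.trans hwS'
    obtain rfl : v = v' := hwT.symm.trans hwT'
    rfl
  · rintro ⟨T, hT, hwT⟩
    refine ⟨⟨⟨(weight A fun p => T ⟨p.1, hmA p⟩, weight B fun p => T ⟨p.1, hmB p⟩),
      HasAntidiagonal.mem_antidiagonal.2 ((hw T).symm.trans hwT)⟩,
      ⟨fun p => T ⟨p.1, hmA p⟩, ⟨fun p q => hT.row_weak ⟨p.1, hmA p⟩ ⟨q.1, hmA q⟩,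
        fun p q => hT.col_strict ⟨p.1, hmA p⟩ ⟨q.1, hmA q⟩⟩, rfl⟩,
      ⟨fun p => T ⟨p.1, hmB p⟩, ⟨fun p q => hT.row_weak ⟨p.1, hmB p⟩ ⟨q.1, hmB q⟩,
        fun p q => hT.col_strict ⟨p.1, hmB p⟩ ⟨q.1, hmB q⟩⟩, rfl⟩⟩, ?_⟩
    apply Subtype.ext
    funext p
    rcases hcases p with ⟨p, rfl⟩ | ⟨p, rfl⟩
    · exact gA _ _ p
    · exact gB _ _ p

/-! ### Rotated diagrams and complements in the square. -/

theorem mem_rotate {r c i j : ℕ} {D : Finset (ℕ × ℕ)} (hD : ∀ p ∈ D, p.1 < r ∧ p.2 < c) :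
    (i, j) ∈ rotate r c D ↔ i < r ∧ j < c ∧ (r - 1 - i, c - 1 - j) ∈ D := by
  simp only [rotate, mem_image, Prod.mk.injEq, Prod.exists]
  constructor
  · rintro ⟨a, b, h, rfl, rfl⟩
    obtain ⟨h1, h2⟩ : a < r ∧ b < c := hD _ h
    refine ⟨by omega, by omega, ?_⟩
    rwa [show r - 1 - (r - 1 - a) = a by omega, show c - 1 - (c - 1 - b) = b by omega]
  · rintro ⟨h1, h2, h3⟩
    exact ⟨_, _, h3, by omega, by omega⟩

theorem card_rotate {r c : ℕ} {D : Finset (ℕ × ℕ)} (hD : ∀ p ∈ D, p.1 < r ∧ p.2 < c) :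
    (rotate r c D).card = D.card := by
  refine Finset.card_image_of_injOn ?_
  rintro ⟨i, j⟩ h ⟨i', j'⟩ h' he
  obtain ⟨h1, h2⟩ : i < r ∧ j < c := hD _ h
  obtain ⟨h3, h4⟩ : i' < r ∧ j' < c := hD _ h'
  simp only [Prod.mk.injEq] at he ⊢
  omega

theorem mem_complement {m i j : ℕ} {μ : YoungDiagram} :
    (i, j) ∈ complement m μ ↔ i < m ∧ j < m ∧ ¬ m - 1 - j < μ.rowLen (m - 1 - i) := by
  change (i, j) ∈ rotate m m _ ↔ _
  rw [mem_rotate fun p hp => by simpa using (mem_sdiff.1 hp).1, mem_sdiff,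
    YoungDiagram.mem_cells, YoungDiagram.mem_iff_lt_rowLen, mem_product, mem_range, mem_range]
  refine and_congr_right fun h1 => and_congr_right fun h2 => and_iff_right ⟨?_, ?_⟩ <;>
  · dsimp only
    omega

theorem rowLen_complement {m i : ℕ} {μ : YoungDiagram} (hi : i < m) :
    (complement m μ).rowLen i = m - μ.rowLen (m - 1 - i) := by
  refine eq_of_forall_lt_iff fun j => ?_
  rw [← YoungDiagram.mem_iff_lt_rowLen, mem_complement]
  omega

theorem mem_bounds {μ : YoungDiagram} {i j : ℕ} (h : j < μ.rowLen i) :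
    i < μ.colLen 0 ∧ j < μ.rowLen 0 := by
  refine ⟨?_, h.trans_le (μ.rowLen_anti 0 i (Nat.zero_le i))⟩
  by_contra hc
  rw [rowLen_eq_zero_of_colLen_le (not_lt.1 hc)] at h
  omega

theorem sdiff_bounds (μ η : YoungDiagram) :
    ∀ p ∈ μ.cells \ η.cells, p.1 < μ.colLen 0 ∧ p.2 < μ.rowLen 0 := fun _ hp =>
  mem_bounds (YoungDiagram.mem_iff_lt_rowLen.1 (mem_sdiff.1 hp).1)

/-- The shift moves `(μ/η)^*` from its own bounding rectangle to the lower right corner of the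
square of side `m`. -/
theorem mem_shift_rotatedSkew {μ η : YoungDiagram} {m i j : ℕ}
    (h1 : μ.colLen 0 ≤ m) (h2 : μ.rowLen 0 ≤ m) :
    (i, j) ∈ shift (m - μ.colLen 0) (m - μ.rowLen 0) (rotatedSkew μ η) ↔
      i < m ∧ j < m ∧ m - 1 - j < μ.rowLen (m - 1 - i) ∧ ¬ m - 1 - j < η.rowLen (m - 1 - i) := by
  rw [mem_shift, rotatedSkew, mem_rotate (sdiff_bounds μ η), mem_sdiff, YoungDiagram.mem_cells,
    YoungDiagram.mem_cells, YoungDiagram.mem_iff_lt_rowLen, YoungDiagram.mem_iff_lt_rowLen]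
  constructor
  · rintro ⟨h3, h4, h5, h6, h7⟩
    rw [show m - 1 - i = μ.colLen 0 - 1 - (i - (m - μ.colLen 0)) by omega,
      show m - 1 - j = μ.rowLen 0 - 1 - (j - (m - μ.rowLen 0)) by omega]
    exact ⟨by omega, by omega, h7⟩
  · rintro ⟨h3, h4, h5, h6⟩
    obtain ⟨h7, h8⟩ := mem_bounds h5
    rw [show μ.colLen 0 - 1 - (i - (m - μ.colLen 0)) = m - 1 - i by omega,
      show μ.rowLen 0 - 1 - (j - (m - μ.rowLen 0)) = m - 1 - j by omega]
    exact ⟨by omega, by omega, by omega, by omega, h5, h6⟩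

theorem complement_le_complement {m : ℕ} {μ η : YoungDiagram} (h : η ≤ μ) :
    complement m μ ≤ complement m η := by
  rintro ⟨i, j⟩ hp
  have hp' := mem_complement.1 hp
  exact mem_complement.2 ⟨hp'.1, hp'.2.1, fun h' => hp'.2.2 (h'.trans_le (le_iff_rowLen.1 h _))⟩

/-- Up to translation, `(μ/η)^*` is the ordinary skew shape `η^c / μ^c` inside a square large enough
for `μ`. -/
theorem hasSchurExpansion_rotatedSkew {μ η : YoungDiagram} (h : η ≤ μ) :
    HasSchurExpansion (diagramSchur (rotatedSkew μ η)) := by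
  set m := μ.rowLen 0 + μ.colLen 0 with hm
  have he : shift (m - μ.colLen 0) (m - μ.rowLen 0) (rotatedSkew μ η) =
      (complement m η).cells \ (complement m μ).cells := by
    ext ⟨i, j⟩
    rw [mem_shift_rotatedSkew (by omega) (by omega), mem_sdiff, YoungDiagram.mem_cells,
      YoungDiagram.mem_cells, mem_complement, mem_complement]
    tauto
  rw [← diagramSchur_shift (m - μ.colLen 0) (m - μ.rowLen 0), he]
  exact hasSchurExpansion_sdiff (complement_le_complement h)

theorem hasSchurExpansion_conjCompl (m : ℕ) (μ : YoungDiagram) :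
    HasSchurExpansion (conjCompl m μ) :=
  (hasSchurExpansion_schur _).mul (hasSchurExpansion_schur _)

/-! ### The partitions `(η^c + γ, σ)` and their coefficients. -/

theorem IsAttached.rowLen_upper {m : ℕ} {η γ σ lam : YoungDiagram} (h : IsAttached m η γ σ lam)
    {i : ℕ} (hi : i < m) : lam.rowLen i = m - η.rowLen (m - 1 - i) + γ.rowLen i := by
  rw [h.upper i hi, rowLen_complement hi]

theorem IsAttached.rowLen_eq_zero {m : ℕ} {η γ σ lam : YoungDiagram}
    (h : IsAttached m η γ σ lam) {i : ℕ} (hi : i < m) :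
    η.rowLen (m - 1 - i) = 0 ∨ γ.rowLen i = 0 := by
  have := h.height_le
  rcases Nat.lt_or_ge i (γ.colLen 0) with h1 | h1
  · exact Or.inl (rowLen_eq_zero_of_colLen_le (by omega))
  · exact Or.inr (rowLen_eq_zero_of_colLen_le h1)

/-- For the forward direction, a cell of `η` outside `μ` rotates to a cell of `μ^c`. It is missing
from `lam`, because `γ` does not reach the rows of `η^*`. -/
theorem IsAttached.complement_le_iff {m : ℕ} {η γ σ lam μ : YoungDiagram}
    (h : IsAttached m η γ σ lam) : complement m μ ≤ lam ↔ η ≤ μ := by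
  constructor
  · rintro hle ⟨a, b⟩ hη
    rw [YoungDiagram.mem_iff_lt_rowLen] at hη ⊢
    by_contra hμ
    obtain ⟨h1, h2⟩ := mem_bounds hη
    have h3 := h.width_le
    have h4 := h.height_le
    have hmem : (m - 1 - a, m - 1 - b) ∈ complement m μ := by
      rw [mem_complement, show m - 1 - (m - 1 - a) = a by omega,
        show m - 1 - (m - 1 - b) = b by omega]
      exact ⟨by omega, by omega, hμ⟩
    have h5 := YoungDiagram.mem_iff_lt_rowLen.1 (hle hmem)
    have h6 := h.rowLen_eq_zero (i := m - 1 - a) (by omega)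
    rw [h.rowLen_upper (by omega)] at h5
    rw [show m - 1 - (m - 1 - a) = a by omega] at h5 h6
    omega
  · rintro hle ⟨i, j⟩ hp
    obtain ⟨h1, h2, h3⟩ := mem_complement.1 hp
    rw [YoungDiagram.mem_iff_lt_rowLen, h.rowLen_upper h1]
    have := le_iff_rowLen.1 hle (m - 1 - i)
    omega

/-- Checked row by row: above row `m`, each row meets at most one of `γ` and `η^*`; from row `m` on,
only `σ` is present. -/
theorem IsAttached.sdiff_eq {m : ℕ} {η γ σ lam μ : YoungDiagram}
    (h : IsAttached m η γ σ lam) (hm : μ.rowLen 0 + μ.colLen 0 ≤ m) (hη : η ≤ μ)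
    (hγ : γ.colLen 0 ≤ μ.rowLen 0) :
    lam.cells \ (complement m μ).cells = shift 0 m γ.cells ∪ shift m 0 σ.cells ∪
      shift (m - μ.colLen 0) (m - μ.rowLen 0) (rotatedSkew μ η) := by
  ext ⟨i, j⟩
  rw [mem_union, mem_union, mem_shift_rotatedSkew (by omega) (by omega), mem_shift, mem_shift,
    mem_sdiff]
  simp only [YoungDiagram.mem_cells, YoungDiagram.mem_iff_lt_rowLen (μ := lam),
    YoungDiagram.mem_iff_lt_rowLen (μ := γ), YoungDiagram.mem_iff_lt_rowLen (μ := σ),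
    mem_complement, Nat.sub_zero]
  have h1 : γ.colLen 0 ≤ i → γ.rowLen i = 0 := rowLen_eq_zero_of_colLen_le
  rcases Nat.lt_or_ge i m with hi | hi
  · rw [h.rowLen_upper hi]
    have h2 := h.rowLen_eq_zero hi
    have h3 : μ.colLen 0 ≤ m - 1 - i → μ.rowLen (m - 1 - i) = 0 := rowLen_eq_zero_of_colLen_le
    have h4 := le_iff_rowLen.1 hη (m - 1 - i)
    have h5 := μ.rowLen_anti 0 (m - 1 - i) (Nat.zero_le _)
    omega
  · have h2 := h.lower (i - m)
    rw [Nat.add_sub_cancel' hi] at h2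
    rw [h2]
    omega

theorem card_transpose (μ : YoungDiagram) : μ.transpose.card = μ.card := by
  simp [YoungDiagram.card, YoungDiagram.transpose]

/-- The boxes of `lam / μ^c` fall into three disconnected pieces. -/
theorem IsAttached.diagramSchur_sdiff {m : ℕ} {η γ σ lam μ : YoungDiagram}
    (h : IsAttached m η γ σ lam) (hm : μ.rowLen 0 + μ.colLen 0 ≤ m) (hη : η ≤ μ)
    (hcard : γ.card + σ.card = η.card)
    (hγ : γ.colLen 0 ≤ μ.rowLen 0) (hσ : σ.rowLen 0 ≤ μ.colLen 0) :
    diagramSchur (lam.cells \ (complement m μ).cells) =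
      schur γ * schur σ * diagramSchur (rotatedSkew μ η) ∧
    (lam.cells \ (complement m μ).cells).card = μ.transpose.card := by
  have h1 : ∀ p ∈ shift 0 m γ.cells, ∀ q ∈ shift m 0 σ.cells, p.1 ≠ q.1 ∧ p.2 ≠ q.2 := by
    rintro ⟨i, j⟩ hp ⟨i', j'⟩ hq
    obtain ⟨-, hp2, hp3⟩ := mem_shift.1 hp
    obtain ⟨hq1, -, hq3⟩ := mem_shift.1 hq
    have := mem_bounds (YoungDiagram.mem_iff_lt_rowLen.1 hp3)
    have := mem_bounds (YoungDiagram.mem_iff_lt_rowLen.1 hq3)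
    dsimp only
    omega
  -- The rotated piece occupies the last `ℓ(μ)` rows and last `μ_1` columns of the square. Since
  -- `ℓ(γ) ≤ μ_1 ≤ m - ℓ(μ)` and `σ_1 ≤ ℓ(μ) ≤ m - μ_1`, `γ` stays above it and `σ` to its left.
  have h2 : ∀ p ∈ shift 0 m γ.cells ∪ shift m 0 σ.cells,
      ∀ q ∈ shift (m - μ.colLen 0) (m - μ.rowLen 0) (rotatedSkew μ η),
        p.1 ≠ q.1 ∧ p.2 ≠ q.2 := by
    rintro ⟨i, j⟩ hp ⟨i', j'⟩ hq
    have hq1 := (mem_shift.1 hq)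
    have hq2 := (mem_shift_rotatedSkew (by omega) (by omega)).1 hq
    dsimp only
    rcases mem_union.1 hp with hp | hp
    · obtain ⟨-, hp2, hp3⟩ := mem_shift.1 hp
      have := mem_bounds (YoungDiagram.mem_iff_lt_rowLen.1 hp3)
      omega
    · obtain ⟨hp1, -, hp3⟩ := mem_shift.1 hp
      have := mem_bounds (YoungDiagram.mem_iff_lt_rowLen.1 hp3)
      omega
  have hd1 : Disjoint (shift 0 m γ.cells) (shift m 0 σ.cells) :=
    Finset.disjoint_left.2 fun p hA hB => (h1 p hA p hB).1 rfl
  have hd2 : Disjoint (shift 0 m γ.cells ∪ shift m 0 σ.cells)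
      (shift (m - μ.colLen 0) (m - μ.rowLen 0) (rotatedSkew μ η)) :=
    Finset.disjoint_left.2 fun p hA hB => (h2 p hA p hB).1 rfl
  rw [h.sdiff_eq hm hη hγ]
  refine ⟨?_, ?_⟩
  · rw [diagramSchur_union h2, diagramSchur_union h1, diagramSchur_shift, diagramSchur_shift,
      diagramSchur_shift, schur, schur]
  · rw [card_union_of_disjoint hd2, card_union_of_disjoint hd1, card_shift, card_shift,
      card_shift, rotatedSkew, card_rotate (sdiff_bounds μ η), card_transpose]
    have := card_sdiff_add hη
    have h3 : γ.cells.card + σ.cells.card = η.card := hcard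
    omega

theorem colLen_le_of_le {κ lam : YoungDiagram} (h : κ ≤ lam) : κ.colLen 0 ≤ lam.colLen 0 := by
  by_contra hc
  exact lt_irrefl _ (YoungDiagram.mem_iff_lt_colLen.1
    (h (YoungDiagram.mem_iff_lt_colLen.2 (not_le.1 hc))))

theorem IsAttached.schurCoeff_conjCompl {m : ℕ} {η γ σ lam μ : YoungDiagram}
    (h : IsAttached m η γ σ lam) (hm : μ.rowLen 0 + μ.colLen 0 ≤ m) (hη : η ≤ μ)
    (hcard : γ.card + σ.card = η.card) :
    schurCoeff lam (conjCompl m μ) =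
      schurCoeff μ.transpose (schur γ * schur σ * diagramSchur (rotatedSkew μ η)) := by
  have hle := h.complement_le_iff.2 hη
  have hrot := hasSchurExpansion_rotatedSkew hη
  by_cases hγ : γ.colLen 0 ≤ μ.rowLen 0
  swap
  -- With `ℓ(μ') = μ_1`, row `μ_1` of a shape in the product is at most the first row of `μ^c`,
  -- hence at most `m`. In `lam` that row contains a cell of `γ`, so it is longer than `m`.
  · have h1 : schurCoeff lam (conjCompl m μ) = 0 := by
      refine schurCoeff_eq_zero (schur_mul_schur_mem_span _ _) fun hmem => ?_
      have h2 := hmem.2.2 0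
      have h3 := h.height_le
      have h4 : 0 < γ.rowLen (μ.rowLen 0) := YoungDiagram.mem_iff_lt_rowLen.1
        (YoungDiagram.mem_iff_lt_colLen.2 (not_le.1 hγ))
      rw [zero_add, YoungDiagram.colLen_transpose, h.rowLen_upper (by omega),
        rowLen_complement (by omega)] at h2
      have h5 := h.rowLen_eq_zero (i := μ.rowLen 0) (by omega)
      omega
    rw [h1, mul_assoc, schurCoeff_schur_mul_eq_zero ((hasSchurExpansion_schur σ).mul hrot)]
    exact fun hc => hγ ((colLen_le_of_le hc).trans_eq (YoungDiagram.colLen_transpose μ 0))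
  by_cases hσ : σ.rowLen 0 ≤ μ.colLen 0
  swap
  -- Now the roles are exchanged: `μ^c` has at most `m` rows, so row `m` of a shape in the product
  -- is at most `μ'_1 = ℓ(μ)`, whereas `lam` has `σ_1` there.
  · have h1 : schurCoeff lam (conjCompl m μ) = 0 := by
      rw [conjCompl, mul_comm]
      refine schurCoeff_eq_zero (schur_mul_schur_mem_span _ _) fun hmem => ?_
      have h2 := hmem.2.2 0
      rw [zero_add, YoungDiagram.rowLen_transpose] at h2
      have h3 : (complement m μ).colLen 0 ≤ m := by
        by_contra hc
        have := (mem_complement.1 (YoungDiagram.mem_iff_lt_colLen.2 (not_le.1 hc))).1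
        omega
      have h4 := lam.rowLen_anti _ _ h3
      have h5 := h.lower 0
      rw [add_zero] at h5
      omega
    rw [h1, mul_comm (schur γ), mul_assoc,
      schurCoeff_schur_mul_eq_zero ((hasSchurExpansion_schur γ).mul hrot)]
    exact fun hc => hσ ((le_iff_rowLen.1 hc 0).trans_eq (YoungDiagram.rowLen_transpose μ 0))
  obtain ⟨h1, h2⟩ := h.diagramSchur_sdiff hm hη hcard hγ hσ
  rw [conjCompl, schurCoeff_mul_eq hle h2, h1]

/-- For `η ⊆ μ` the formula for the coefficient does not mention `m`; otherwise neither shape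
contains its `μ^c` and both coefficients vanish. -/
theorem schurCoeff_conjCompl_eq {m₁ m₂ : ℕ} {η γ σ lam₁ lam₂ μ : YoungDiagram}
    (h₁ : IsAttached m₁ η γ σ lam₁) (h₂ : IsAttached m₂ η γ σ lam₂)
    (hm₁ : μ.rowLen 0 + μ.colLen 0 ≤ m₁) (hm₂ : μ.rowLen 0 + μ.colLen 0 ≤ m₂)
    (hcard : γ.card + σ.card = η.card) :
    schurCoeff lam₁ (conjCompl m₁ μ) = schurCoeff lam₂ (conjCompl m₂ μ) := by
  by_cases hη : η ≤ μ
  · rw [h₁.schurCoeff_conjCompl hm₁ hη hcard, h₂.schurCoeff_conjCompl hm₂ hη hcard]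
  · rw [conjCompl, mul_comm, schurCoeff_schur_mul_eq_zero (hasSchurExpansion_schur _)
        fun h => hη (h₁.complement_le_iff.1 h),
      conjCompl, mul_comm, schurCoeff_schur_mul_eq_zero (hasSchurExpansion_schur _)
        fun h => hη (h₂.complement_le_iff.1 h)]

end SchurStability

theorem mainTheorem12 :
    (∀ (μ : YoungDiagram) (m : ℕ), μ.rowLen 0 + μ.colLen 0 ≤ m →
      SchurStability.HasSchurExpansion (SchurStability.conjCompl m μ) ∧
      ∀ η γ σ : YoungDiagram, η ≤ μ → γ.card + σ.card = η.card →
        SchurStability.HasSchurExpansion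
          (SchurStability.schur γ * SchurStability.schur σ *
            SchurStability.diagramSchur (SchurStability.rotatedSkew μ η)) ∧
        ∀ lam : YoungDiagram, SchurStability.IsAttached m η γ σ lam →
          SchurStability.schurCoeff lam (SchurStability.conjCompl m μ) =
            SchurStability.hallInner (SchurStability.schur μ.transpose)
              (SchurStability.schur γ * SchurStability.schur σ *
                SchurStability.diagramSchur (SchurStability.rotatedSkew μ η)) ∧
          ∀ lam' : YoungDiagram, SchurStability.IsAttached m η σ γ lam' →
            SchurStability.schurCoeff lam' (SchurStability.conjCompl m μ) =
              SchurStability.schurCoeff lam (SchurStability.conjCompl m μ)) ∧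
    (∀ ν μ : YoungDiagram, ν ≤ μ → μ.card = ν.card + 1 →
      ∀ m₁ m₂ : ℕ, μ.rowLen 0 + μ.colLen 0 ≤ m₁ → μ.rowLen 0 + μ.colLen 0 ≤ m₂ →
        SchurStability.HasSchurExpansion
          (SchurStability.conjCompl m₁ μ - SchurStability.conjCompl m₁ ν) ∧
        SchurStability.HasSchurExpansion
          (SchurStability.conjCompl m₂ μ - SchurStability.conjCompl m₂ ν) ∧
        ∀ η γ σ lam₁ lam₂ : YoungDiagram, γ.card + σ.card = η.card →
          SchurStability.IsAttached m₁ η γ σ lam₁ → SchurStability.IsAttached m₂ η γ σ lam₂ →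
          SchurStability.hallInner (SchurStability.schur lam₁)
              (SchurStability.conjCompl m₁ μ - SchurStability.conjCompl m₁ ν) =
            SchurStability.hallInner (SchurStability.schur lam₂)
              (SchurStability.conjCompl m₂ μ - SchurStability.conjCompl m₂ ν)) := by
  open SchurStability in
  refine ⟨fun μ m hm => ⟨hasSchurExpansion_conjCompl m μ, fun η γ σ hη hcard =>
    ⟨((hasSchurExpansion_schur γ).mul (hasSchurExpansion_schur σ)).mul
      (hasSchurExpansion_rotatedSkew hη), fun lam h => ⟨?_, fun lam' h' => ?_⟩⟩⟩,
    fun ν μ hν _ m₁ m₂ hm₁ hm₂ => ?_⟩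
  · rw [hallInner_schur, h.schurCoeff_conjCompl hm hη hcard]
  -- Exchanging `γ` and `σ` only permutes the commuting factors `s_γ` and `s_σ`.
  · rw [h.schurCoeff_conjCompl hm hη hcard,
      h'.schurCoeff_conjCompl hm hη ((add_comm _ _).trans hcard), mul_comm (schur σ)]
  · have e := hasSchurExpansion_conjCompl
    refine ⟨(e m₁ μ).sub (e m₁ ν), (e m₂ μ).sub (e m₂ ν),
      fun η γ σ lam₁ lam₂ hcard h₁ h₂ => ?_⟩
    -- Since `ν ⊆ μ`, the bound on `m₁` and `m₂` also holds for `ν`, so stability applies to each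
    -- term of the difference separately.
    have h1 := le_iff_rowLen.1 hν 0
    have h2 := colLen_le_of_le hν
    rw [hallInner_schur, hallInner_schur, schurCoeff_sub (e m₁ μ) (e m₁ ν),
      schurCoeff_sub (e m₂ μ) (e m₂ ν), schurCoeff_conjCompl_eq h₁ h₂ hm₁ hm₂ hcard,
      schurCoeff_conjCompl_eq h₁ h₂ (μ := ν) (by omega) (by omega) hcard]
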